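/- Let $d\ge 1$, let $\mathbb S^d$ be the unit sphere of $\mathbb R^{d+1}$ with North Pole $N$, surface measure $\lambda$ and $\omega_d=\lambda(\mathbb S^d)$, and let $C(\mathbb S^d)$ be the space of continuous functions $\mathbb S^d\to\mathbb R$ with the uniform topology. Let $\kappa\in C^1([-1,1])$ satisfy $\kappa(t)=\sum_{q\ge 0}\frac{J_q^2}{q!}t^q$ on $[-1,1]$ with $J_q\in\mathbb R$ non-zero for infinitely many $q$, and $\kappa(1)=1$. Assume that $\kappa'(1)=1$ and that, for some $c\ne 0$ and $\rho>1$, $$1-\kappa(t)=\kappa'(1)(1-t)-c(1-t)^\rho+o\big((1-t)^\rho\big)\qquad (t\to 1^-).$$ Let $\kappa_L$ be the $L$-fold composition of $\kappa$ with itself and, for each $L\ge 1$, let $T_L$ be a centred Gaussian random field on $\mathbb S^d$ with continuous paths and $\mathrm{Cov}(T_L(x),T_L(y))=\kappa_L(\langle x,y\rangle)$, all defined on one probability space. Put $a_{00,L}=\int_{\mathbb S^d}T_L\,\omega_d^{-1/2}\,d\lambda$, so that $a_{00,L}/\sqrt{\omega_d}$ is the spherical average of $T_L$. Recall that $X_L$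 satisfies the LDP with speed $v_L$ and rate function $I$ if $I$ is lower semicontinuous with values in $[0,\infty]$ (not necessarily with compact level sets), $\limsup_L \frac1{v_L}\log P(X_L\in C)\le-\inf_C I$ for all closed $C$, and $\liminf_L\frac1{v_L}\log P(X_L\in O)\ge-\inf_O I$ for all open $O$. 1. Neither $\{T_L-T_L(N)\}_{L\ge1}$ nor $\{T_L-a_{00,L}/\sqrt{\omega_d}\}_{L\ge1}$ satisfies an LDP in $C(\mathbb S^d)$ with speed $v_L=L^{1/(\rho-1)}$, for any rate function. 2. The limit $\mathfrak S(t)=\lim_{L\to\infty}L^{1/(\rho-1)}(1-\kappa_L(t))$ exists in $\mathbb R$ for every $t\in[-1,1]$. For distinct $x_1,\dots,x_m\in\mathbb S^d$ and $y\in\mathbb R^m$, $m\ge 1$, put $$I_{i;\mathfrak S}(y;x)=\sup_{\theta\in\mathbb R^m}\Big\{\langle\theta,y\rangle-\tfrac12\langle\theta,B_i(x)\theta\rangle\Big\},\qquad i=1,2,$$ where $B_1(x)$ has entries $\mathfrak S(\langle x_j,N\rangle)+\mathfrak S(\langle x_k,N\rangle)-\mathfrak S(\langle x_j,x_k\rangle)$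 and $B_2(x)$ has entries $\frac{\int_{-1}^1\mathfrak S(t)(1-t^2)^{d/2-1}dt}{\int_{-1}^1(1-t^2)^{d/2-1}dt}-\mathfrak S(\langle x_j,x_k\rangle)$, and let $I_i(f)$ be the supremum of $I_{i;\mathfrak S}(f(x_1),\dots,f(x_m);x_1,\dots,x_m)$ over all $m\ge1$ and all distinct $x_1,\dots,x_m$. Then $I_1(f)=\infty$ for every non-constant $f\in C(\mathbb S^d)$, and $I_2(f)=\infty$ for every $f\in C(\mathbb S^d)$ that is not identically $0$. 3. For each $i\in\{1,2\}$ there are $m\ge 1$, distinct $x_1,\dots,x_m\in\mathbb S^d$ and $y\in\mathbb R^m$ with $I_{i;\mathfrak S}(y;x)<\infty$ but $\inf\{I_i(f): f\in C(\mathbb S^d),\ f(x_j)=y_j \text{ for all } j\}=\infty$. -/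

import Mathlib

open MeasureTheory ProbabilityTheory Filter Topology Set
open scoped ENNReal Nat Matrix

noncomputable section

namespace SparseField

/-! ### Large deviations -/

/-- `P (X L ∈ A)` on the logarithmic scale `1 / v L`, as an extended real number (`log 0 = -∞`). -/
def logProb {Ω 𝒳 : Type*} [MeasurableSpace Ω] (P : Measure Ω) (X : ℕ → Ω → 𝒳) (v : ℕ → ℝ)
    (A : Set 𝒳) (L : ℕ) : EReal :=
  ((1 / v L : ℝ) : EReal) * ENNReal.log (P {ω | X L ω ∈ A})

/-- The sequence `X` satisfies the large deviation principle with speed `v` and rate function `I`;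
a rate function is a lower semicontinuous `[0, ∞]`-valued function, not necessarily a good one. -/
structure SatisfiesLDP {Ω 𝒳 : Type*} [MeasurableSpace Ω] [TopologicalSpace 𝒳] (P : Measure Ω)
    (X : ℕ → Ω → 𝒳) (v : ℕ → ℝ) (I : 𝒳 → ℝ≥0∞) : Prop where
  lsc : LowerSemicontinuous I
  upper : ∀ C : Set 𝒳, IsClosed C →
    limsup (logProb P X v C) atTop ≤ -(⨅ x ∈ C, (I x : EReal))
  lower : ∀ O : Set 𝒳, IsOpen O →
    -(⨅ x ∈ O, (I x : EReal)) ≤ liminf (logProb P X v O) atTop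

/-! ### The sphere -/

/-- The unit sphere `𝕊^d` of `ℝ^(d+1)`. -/
abbrev Sph (d : ℕ) : Type := Metric.sphere (0 : EuclideanSpace ℝ (Fin (d + 1))) 1

/-- The scalar product in `ℝ^(d+1)` of two points of the sphere. -/
def sdot {d : ℕ} (x y : Sph d) : ℝ :=
  inner ℝ (x : EuclideanSpace ℝ (Fin (d + 1))) (y : EuclideanSpace ℝ (Fin (d + 1)))

/-- The North Pole `(0, …, 0, 1)`. -/
def northPole (d : ℕ) : Sph d :=
  ⟨EuclideanSpace.single (Fin.last d) (1 : ℝ), by simp⟩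

/-- The surface (Lebesgue) measure `λ` of the sphere. -/
def surf (d : ℕ) : Measure (Sph d) :=
  (volume : Measure (EuclideanSpace ℝ (Fin (d + 1)))).toSphere

/-- `ω_d`, the total surface measure of the sphere. -/
def totalArea (d : ℕ) : ℝ := (surf d).real univ

/-- The coefficient `a₀₀` of `f` along the constant spherical harmonic `Y₀₀ = ω_d^(-1/2)`. -/
def a00 {d : ℕ} (f : C(Sph d, ℝ)) : ℝ := ∫ y, f y * (1 / √(totalArea d)) ∂(surf d)

/-- `f - f(N)`. -/
def centreNorth {d : ℕ} (f : C(Sph d, ℝ)) : C(Sph d, ℝ) :=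
  f - ContinuousMap.const _ (f (northPole d))

/-- `f - a₀₀ / √ω_d`, that is, `f` minus its spherical average. -/
def centreMean {d : ℕ} (f : C(Sph d, ℝ)) : C(Sph d, ℝ) :=
  f - ContinuousMap.const _ (a00 f / √(totalArea d))

/-! ### Covariance kernels and fields -/

/-- The covariance functions `κ` considered: `C¹` on `[-1, 1]`, with an expansion
`κ t = ∑ J_q² / q! * t^q` on `[-1, 1]` in which infinitely many `J_q` are non-zero, and `κ 1 = 1`.
Only the values of `κ` on `[-1, 1]` matter. -/
structure IsKernel (κ : ℝ → ℝ) : Prop where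
  contDiffOn : ContDiffOn ℝ 1 κ (Icc (-1) 1)
  series : ∃ J : ℕ → ℝ, {q | J q ≠ 0}.Infinite ∧
    ∀ t ∈ Icc (-1 : ℝ) 1, HasSum (fun q : ℕ => J q ^ 2 / (q ! : ℝ) * t ^ q) (κ t)
  map_one : κ 1 = 1

/-- `κ'(1)`, the (one-sided) derivative at the endpoint `1` of `κ` on `[-1, 1]`. -/
def derivOne (κ : ℝ → ℝ) : ℝ := derivWithin κ (Icc (-1) 1) 1

/-- Covariance regularity with constants `c ≠ 0` and `ρ > 1`:
`1 - κ t = κ'(1) (1 - t) - c (1 - t)^ρ + o((1 - t)^ρ)` as `t → 1⁻`. -/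
def CovRegular (κ : ℝ → ℝ) (c ρ : ℝ) : Prop :=
  c ≠ 0 ∧ 1 < ρ ∧
    (fun t : ℝ => (1 - κ t) - (derivOne κ * (1 - t) - c * (1 - t) ^ ρ))
      =o[𝓝[<] 1] (fun t : ℝ => (1 - t) ^ ρ)

/-- `T` is a centred Gaussian random field on the sphere with continuous paths and with
`Cov (T x, T y) = K ⟨x, y⟩`; its law is therefore invariant under rotations (isotropy). -/
structure IsIsotropicField {Ω : Type*} [MeasurableSpace Ω] (P : Measure Ω) {d : ℕ}
    (T : Ω → C(Sph d, ℝ)) (K : ℝ → ℝ) : Prop where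
  gaussian : IsGaussianProcess (fun (x : Sph d) (ω : Ω) => T ω x) P
  centred : ∀ x, ∫ ω, T ω x ∂P = 0
  cov_eq : ∀ x y, cov[fun ω => T ω x, fun ω => T ω y; P] = K (sdot x y)

/-- The speed `L^(1/(ρ-1))`. -/
def speed (ρ : ℝ) (L : ℕ) : ℝ := (L : ℝ) ^ (1 / (ρ - 1))

/-! ### The rate functions -/

/-- `sup_θ { ⟨θ, y⟩ - ½ ⟨θ, B θ⟩ }`. -/
def quadRate {m : ℕ} (B : Matrix (Fin m) (Fin m) ℝ) (y : Fin m → ℝ) : EReal :=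
  ⨆ θ : Fin m → ℝ, ((θ ⬝ᵥ y - 1 / 2 * (θ ⬝ᵥ (B *ᵥ θ)) : ℝ) : EReal)

/-- The limiting covariance matrix for the centring at the North Pole. -/
def B₁ {d : ℕ} (g : ℝ → ℝ) {m : ℕ} (x : Fin m → Sph d) : Matrix (Fin m) (Fin m) ℝ :=
  Matrix.of fun i j =>
    g (sdot (x i) (northPole d)) + g (sdot (x j) (northPole d)) - g (sdot (x i) (x j))

/-- The limiting covariance matrix for the centring at the spherical average. -/
def B₂ {d : ℕ} (g : ℝ → ℝ) {m : ℕ} (x : Fin m → Sph d) : Matrix (Fin m) (Fin m) ℝ :=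
  Matrix.of fun i j =>
    (∫ t in (-1 : ℝ)..1, g t * (1 - t ^ 2) ^ ((d : ℝ) / 2 - 1)) /
      (∫ t in (-1 : ℝ)..1, (1 - t ^ 2) ^ ((d : ℝ) / 2 - 1)) - g (sdot (x i) (x j))

/-- The candidate functional rate function: the supremum of the finite-dimensional rate functions
over all finite configurations of distinct points. -/
def supRate {d : ℕ} (B : ∀ {m : ℕ}, (Fin m → Sph d) → Matrix (Fin m) (Fin m) ℝ)
    (f : C(Sph d, ℝ)) : EReal :=
  ⨆ (m : ℕ) (_ : 1 ≤ m) (x : Fin m → Sph d) (_ : Function.Injective x),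
    quadRate (B x) (fun i => f (x i))

/-- The finite-dimensional rate functions are not the ones that the contraction principle would
yield from `supRate B`: for some distinct points `x` and some values `y` the former is finite while
the infimum of the latter over all continuous `f` with `f(x_i) = y_i` is infinite. -/
def MarginalsFail {d : ℕ} (B : ∀ {m : ℕ}, (Fin m → Sph d) → Matrix (Fin m) (Fin m) ℝ) : Prop :=
  ∃ (m : ℕ) (x : Fin m → Sph d) (y : Fin m → ℝ), 1 ≤ m ∧ Function.Injective x ∧
    quadRate (B x) y < ⊤ ∧
    (⨅ (f : C(Sph d, ℝ)) (_ : ∀ i, f (x i) = y i), supRate B f) = ⊤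

end SparseField

end

/-!
The whole theorem reflects one fact: the rescaled covariances degenerate to those of a white noise.

*The profile.* A kernel is a strictly convex power series on `[0, 1]` whose tangent at `1` is the
diagonal, so `κ t > t` on `[-1, 1)` and the iterates increase to `1` (`IsKernel.tendsto_iterate`).
In the variable `(1 - t) ^ (-(ρ - 1))` one step of `κ` is asymptotically a translation by
`(ρ - 1) * c`, hence by Cesàro `L ^ (1 / (ρ - 1)) * (1 - κ^[L] t)` tends to a positive
constant `s` that does not depend on `t` (`tendsto_profile`). The exceptions are the points where
`κ t = 1`: these are `t = 1` and, for an even kernel, `t = -1`, and there the limit is `0`.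

*Infinite rates.* On finite sets of points without antipodal pairs the limiting quadratic form is
`s` times the sum of squares, for all weights (`B₂`) or for weights of total mass zero (`B₁`).
Weights of fixed size on `K` points near a place where `f` does not vanish, or opposite weights
near two places where `f` takes different values, therefore contribute a multiple of `K` to the
functional rate, which is infinite by continuity of `f` (`supRate_eq_top_of_ne_zero`,
`supRate_eq_top_of_ne`). For `B₁` the non-zero constants also have infinite rate, since the field
centred at the North Pole vanishes there. A single point of positive variance still
has a finite rate, whence the failure of the marginals.

*No large deviation principle.* Both centrings subtract the mean over a probability measure `μ`:
the Dirac mass at the North Pole, or the normalised surface measure. Linear functionals of the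
centred field are Gaussian (`IsIsotropicField.isCentredGaussian_centred`), and their rescaled
variances converge to the quadratic form of `B₁` or `B₂` (`tendsto_speed_mul_centredVar`). If a
principle held with some rate function `I`, then Chernoff's bound on half-spaces would give
`supRate B f ≤ I f`, so that `I f = ∞` for all `f ≠ 0`; but the probability that the field exceeds
`1` at a given point is only exponentially small in the speed, so that `I f < ∞` for some `f` with
`f p ≥ 1` (`not_satisfiesLDP`). Compactness of the level sets of `I` plays no role.
-/

noncomputable section

namespace SparseField


/-! ### The kernel and its iterates -/

section Kernel

variable {κ : ℝ → ℝ}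

/-- A non-negative expansion of a kernel, with a non-zero coefficient of degree at least `2`. -/
theorem IsKernel.exists_coeff (hκ : IsKernel κ) :
    ∃ a : ℕ → ℝ, (∀ q, 0 ≤ a q) ∧ (∃ q, 2 ≤ q ∧ 0 < a q) ∧
      ∀ t ∈ Icc (-1 : ℝ) 1, HasSum (fun q => a q * t ^ q) (κ t) := by
  obtain ⟨J, hJ, hs⟩ := hκ.series
  refine ⟨fun q => J q ^ 2 / (q ! : ℝ), fun q => by positivity, ?_, hs⟩
  obtain ⟨q, hq, hq'⟩ := hJ.exists_gt 1
  refine ⟨q, hq', ?_⟩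
  have : J q ≠ 0 := hq
  positivity

theorem IsKernel.continuousOn (hκ : IsKernel κ) : ContinuousOn κ (Icc (-1) 1) :=
  hκ.contDiffOn.continuousOn

theorem IsKernel.abs_le_one (hκ : IsKernel κ) {t : ℝ} (ht : t ∈ Icc (-1 : ℝ) 1) :
    |κ t| ≤ 1 := by
  obtain ⟨a, ha, -, hs⟩ := hκ.exists_coeff
  have h1 : HasSum a 1 := by simpa [hκ.map_one] using hs 1 (by norm_num)
  have hle (q : ℕ) : |a q * t ^ q| ≤ a q := by
    rw [abs_mul, abs_pow, abs_of_nonneg (ha q)]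
    exact mul_le_of_le_one_right (ha q) (pow_le_one₀ (abs_nonneg _) (abs_le.2 ht))
  refine abs_le.2 ⟨?_, ?_⟩
  · exact hasSum_le (fun q => (abs_le.1 (hle q)).1) h1.neg (hs t ht)
  · exact hasSum_le (fun q => (abs_le.1 (hle q)).2) (hs t ht) h1

theorem IsKernel.mapsTo (hκ : IsKernel κ) : MapsTo κ (Icc (-1) 1) (Icc (-1) 1) :=
  fun _ ht => abs_le.1 (hκ.abs_le_one ht)

theorem IsKernel.lt_one (hκ : IsKernel κ) {t : ℝ} (ht : t ∈ Ioo (-1 : ℝ) 1) : κ t < 1 := by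
  obtain ⟨a, ha, ⟨q, hq, haq⟩, hs⟩ := hκ.exists_coeff
  have h1 : HasSum a 1 := by simpa [hκ.map_one] using hs 1 (by norm_num)
  have habs : |t| < 1 := abs_lt.2 ht
  have hpow (n : ℕ) : t ^ n ≤ 1 :=
    (le_abs_self _).trans (by rw [abs_pow]; exact pow_le_one₀ (abs_nonneg _) habs.le)
  have hlt : t ^ q < 1 :=
    (le_abs_self _).trans_lt
      (by rw [abs_pow]; exact pow_lt_one₀ (abs_nonneg _) habs (by omega))
  exact hasSum_lt (i := q) (fun n => mul_le_of_le_one_right (ha n) (hpow n))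
    (mul_lt_of_lt_one_right haq hlt) (hs t ⟨ht.1.le, ht.2.le⟩) h1

theorem IsKernel.monotoneOn (hκ : IsKernel κ) : MonotoneOn κ (Icc 0 1) := by
  obtain ⟨a, ha, -, hs⟩ := hκ.exists_coeff
  intro s hs' t ht hst
  exact hasSum_le (fun q => mul_le_mul_of_nonneg_left (pow_le_pow_left₀ hs'.1 hst q) (ha q))
    (hs s ⟨by linarith [hs'.1], hs'.2⟩) (hs t ⟨by linarith [ht.1], ht.2⟩)

theorem IsKernel.strictConvexOn (hκ : IsKernel κ) : StrictConvexOn ℝ (Icc 0 1) κ := by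
  obtain ⟨a, ha, ⟨q, hq, haq⟩, hs⟩ := hκ.exists_coeff
  refine ⟨convex_Icc 0 1, fun x hx y hy hxy u v hu hv huv => ?_⟩
  have mem {z : ℝ} (hz : z ∈ Icc (0 : ℝ) 1) : z ∈ Icc (-1 : ℝ) 1 := ⟨by linarith [hz.1], hz.2⟩
  have hz : u • x + v • y ∈ Icc (0 : ℝ) 1 := convex_Icc 0 1 hx hy hu.le hv.le huv
  have hR := ((hs x (mem hx)).mul_left u).add ((hs y (mem hy)).mul_left v)
  simp only [smul_eq_mul] at hz ⊢
  refine hasSum_lt (i := q) (fun n => ?_) ?_ (hs _ (mem hz)) hR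
  · have := (convexOn_pow n).2 (mem_Ici.2 hx.1) (mem_Ici.2 hy.1) hu.le hv.le huv
    simp only [smul_eq_mul] at this
    have := mul_le_mul_of_nonneg_left this (ha n)
    linarith
  · have := (strictConvexOn_pow hq).2 (mem_Ici.2 hx.1) (mem_Ici.2 hy.1) hxy hu hv huv
    simp only [smul_eq_mul] at this
    have := mul_lt_mul_of_pos_left this haq
    linarith

/-- A critical kernel lies strictly above the diagonal on `[0, 1)`: it is strictly convex and its
tangent at `1` is the diagonal. -/
theorem IsKernel.lt_map_of_nonneg (hκ : IsKernel κ) (hd : derivOne κ = 1) {t : ℝ}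
    (h0 : 0 ≤ t) (h1 : t < 1) : t < κ t := by
  have hderiv : HasDerivWithinAt κ 1 (Iio 1) 1 := by
    have h := ((hκ.contDiffOn.differentiableOn one_ne_zero) 1 (by norm_num)).hasDerivWithinAt
    rw [show derivWithin κ (Icc (-1) 1) 1 = 1 from hd] at h
    exact h.mono_of_mem_nhdsWithin (Icc_mem_nhdsLT (by norm_num))
  have := hκ.strictConvexOn.slope_lt_of_hasDerivWithinAt_Iio ⟨h0, h1.le⟩ (by norm_num) h1 hderiv
  rw [slope_def_field, hκ.map_one, div_lt_one (by linarith)] at this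
  linarith

/-- On the negative half of the interval a critical kernel exceeds the diagonal by at least its
(positive) value at `0`. -/
theorem IsKernel.add_le_map_of_nonpos (hκ : IsKernel κ) {t : ℝ}
    (h0 : -1 ≤ t) (h1 : t ≤ 0) : t + κ 0 ≤ κ t := by
  obtain ⟨a, ha, -, hs⟩ := hκ.exists_coeff
  have hsum1 : HasSum a 1 := by simpa [hκ.map_one] using hs 1 (by norm_num)
  have ha0 : a 0 = κ 0 := by
    have h := hs 0 (by norm_num)
    refine HasSum.unique ?_ h
    convert hasSum_single (f := fun q => a q * (0 : ℝ) ^ q) 0 (fun q hq => by simp [hq]) using 1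
    simp
  have hdiff : HasSum (fun q => a q * (t ^ q - t)) (κ t - t) := by
    have := (hs t ⟨h0, by linarith⟩).sub (hsum1.mul_right t)
    simpa [mul_sub] using this
  have hpow (q : ℕ) (hq : q ≠ 0) : t ≤ t ^ q := by
    rcases Nat.exists_eq_succ_of_ne_zero hq with ⟨n, rfl⟩
    have habs : |t| ^ n ≤ 1 := pow_le_one₀ (abs_nonneg t) (abs_le.2 ⟨h0, by linarith⟩)
    have : t ^ n ≤ 1 := (le_abs_self _).trans (by rwa [abs_pow])
    rw [pow_succ]
    nlinarith
  have := le_hasSum hdiff 0 fun q hq => mul_nonneg (ha q) (sub_nonneg.2 (hpow q hq))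
  rw [ha0, pow_zero] at this
  have hκ0 : 0 ≤ κ 0 := ha0 ▸ ha 0
  nlinarith

theorem IsKernel.zero_lt_map_zero (hκ : IsKernel κ) (hd : derivOne κ = 1) : 0 < κ 0 :=
  hκ.lt_map_of_nonneg hd le_rfl one_pos

theorem IsKernel.lt_map (hκ : IsKernel κ) (hd : derivOne κ = 1) {t : ℝ}
    (h0 : -1 ≤ t) (h1 : t < 1) : t < κ t := by
  rcases le_or_gt 0 t with h | h
  · exact hκ.lt_map_of_nonneg hd h h1
  · linarith [hκ.add_le_map_of_nonpos h0 h.le, hκ.zero_lt_map_zero hd]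

theorem IsKernel.iterate_mem (hκ : IsKernel κ) {t : ℝ} (ht : t ∈ Icc (-1 : ℝ) 1) (L : ℕ) :
    κ^[L] t ∈ Icc (-1 : ℝ) 1 :=
  hκ.mapsTo.iterate L ht

theorem IsKernel.iterate_one (hκ : IsKernel κ) (L : ℕ) : κ^[L] 1 = 1 :=
  Function.iterate_fixed hκ.map_one L

theorem IsKernel.continuousOn_iterate (hκ : IsKernel κ) (L : ℕ) :
    ContinuousOn κ^[L] (Icc (-1) 1) :=
  hκ.continuousOn.iterate hκ.mapsTo L

theorem IsKernel.mapsTo_Ioo (hκ : IsKernel κ) (hd : derivOne κ = 1) :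
    MapsTo κ (Ioo (-1) 1) (Ioo (-1) 1) :=
  fun _ ht => ⟨ht.1.trans (hκ.lt_map hd ht.1.le ht.2), hκ.lt_one ht⟩

theorem IsKernel.iterate_mem_Ioo (hκ : IsKernel κ) (hd : derivOne κ = 1) {t : ℝ}
    (ht : t ∈ Ioo (-1 : ℝ) 1) (L : ℕ) : κ^[L] t ∈ Ioo (-1 : ℝ) 1 :=
  (hκ.mapsTo_Ioo hd).iterate L ht

/-- The iterates increase to the only fixed point `1`. -/
theorem IsKernel.tendsto_iterate (hκ : IsKernel κ) (hd : derivOne κ = 1) {t : ℝ}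
    (ht : t ∈ Icc (-1 : ℝ) 1) : Tendsto (fun L => κ^[L] t) atTop (𝓝 1) := by
  have hle {s : ℝ} (hs : s ∈ Icc (-1 : ℝ) 1) : s ≤ κ s := by
    rcases hs.2.lt_or_eq with h | rfl
    · exact (hκ.lt_map hd hs.1 h).le
    · exact hκ.map_one.ge
  have hmono : Monotone fun L => κ^[L] t := monotone_nat_of_le_succ fun L => by
    rw [Function.iterate_succ_apply']
    exact hle (hκ.iterate_mem ht L)
  have hbdd : BddAbove (range fun L => κ^[L] t) :=
    ⟨1, by rintro _ ⟨L, rfl⟩; exact (hκ.iterate_mem ht L).2⟩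
  have hlim := tendsto_atTop_ciSup hmono hbdd
  set l := ⨆ L, κ^[L] t with hl
  have hmem : l ∈ Icc (-1 : ℝ) 1 :=
    isClosed_Icc.mem_of_tendsto hlim (Eventually.of_forall fun L => hκ.iterate_mem ht L)
  have hfix : κ l = l := by
    have h1 : Tendsto (fun L => κ (κ^[L] t)) atTop (𝓝 (κ l)) :=
      (hκ.continuousOn l hmem).tendsto.comp (tendsto_nhdsWithin_iff.2
        ⟨hlim, Eventually.of_forall fun L => hκ.iterate_mem ht L⟩)
    refine tendsto_nhds_unique h1 ?_
    simp only [← Function.iterate_succ_apply']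
    exact hlim.comp (tendsto_add_atTop_nat 1)
  rcases hmem.2.lt_or_eq with h | h
  · exact absurd hfix (hκ.lt_map hd hmem.1 h).ne'
  · rwa [h] at hlim

/-- After boundedly many steps every orbit is non-negative, hence dominates the orbit of `0`. -/
theorem IsKernel.exists_iterate_zero_le (hκ : IsKernel κ) (hd : derivOne κ = 1) :
    ∃ n : ℕ, ∀ t ∈ Icc (-1 : ℝ) 1, ∀ L : ℕ, κ^[L] 0 ≤ κ^[L + n] t := by
  obtain ⟨n, hn⟩ := exists_nat_ge (1 / κ 0)
  have h0 := hκ.zero_lt_map_zero hd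
  rw [div_le_iff₀ h0] at hn
  refine ⟨n, fun t ht L => ?_⟩
  have hstep (k : ℕ) : 0 ≤ κ^[k] t ∨ -1 + k * κ 0 ≤ κ^[k] t := by
    induction k with
    | zero => right; simpa using ht.1
    | succ k ih =>
      rw [Function.iterate_succ_apply']
      have hmem := hκ.iterate_mem ht k
      rcases le_or_gt 0 (κ^[k] t) with h | h
      · left
        exact h0.le.trans (hκ.monotoneOn (by norm_num) ⟨h, hmem.2⟩ h)
      · right
        have h1 := hκ.add_le_map_of_nonpos hmem.1 h.le
        have h2 := ih.resolve_left h.not_ge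
        push_cast
        linarith
  have hnn : 0 ≤ κ^[n] t := (hstep n).elim id fun h => by linarith
  rw [Function.iterate_add_apply]
  have hmaps : MapsTo κ (Icc 0 1) (Icc 0 1) := fun s hs =>
    ⟨h0.le.trans (hκ.monotoneOn (by norm_num) hs hs.1), (hκ.mapsTo ⟨by linarith [hs.1], hs.2⟩).2⟩
  have hn1 := (hκ.iterate_mem ht n).2
  induction L with
  | zero => simpa using hnn
  | succ L ih =>
    rw [Function.iterate_succ_apply', Function.iterate_succ_apply']
    exact hκ.monotoneOn (hmaps.iterate L (by norm_num)) (hmaps.iterate L ⟨hnn, hn1⟩) ih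

end Kernel


/-! ### The rate of convergence of the iterates -/

section Rate

variable {κ : ℝ → ℝ} {c ρ : ℝ}

theorem CovRegular.pos (hκ : IsKernel κ) (hd : derivOne κ = 1) (hA : CovRegular κ c ρ) :
    0 < c := by
  obtain ⟨hc, hρ, ho⟩ := hA
  by_contra hneg
  have hc' : c < 0 := lt_of_le_of_ne (not_lt.1 hneg) hc
  have h1 := ho.bound (c := -c / 2) (by linarith)
  have h2 : ∀ᶠ t in 𝓝[<] (1 : ℝ), t ∈ Ioo 0 1 := Ioo_mem_nhdsLT one_pos
  obtain ⟨t, ht1, ht⟩ := (h1.and h2).exists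
  have hp : 0 < (1 - t) ^ ρ := Real.rpow_pos_of_pos (by linarith [ht.2]) _
  have hlt := hκ.lt_map hd (by linarith [ht.1]) ht.2
  rw [hd, Real.norm_eq_abs, Real.norm_eq_abs, abs_of_pos hp] at ht1
  have := (abs_le.1 ht1).1
  nlinarith

/-- In the variable `(1 - t) ^ (-(ρ - 1))` the kernel acts near `t = 1` as a translation. -/
theorem tendsto_rpow_increment (hκ : IsKernel κ) (hd : derivOne κ = 1)
    (hA : CovRegular κ c ρ) :
    Tendsto (fun t => (1 - κ t) ^ (-(ρ - 1)) - (1 - t) ^ (-(ρ - 1))) (𝓝[<] 1)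
      (𝓝 ((ρ - 1) * c)) := by
  obtain ⟨hc, hρ, ho⟩ := hA
  have hev : ∀ᶠ t in 𝓝[<] (1 : ℝ), t ∈ Ioo 0 1 := Ioo_mem_nhdsLT one_pos
  have hquot : Tendsto (fun t => ((1 - κ t) / (1 - t) - 1) / (1 - t) ^ (ρ - 1)) (𝓝[<] 1)
      (𝓝 (-c)) := by
    have h0 := (ho.tendsto_div_nhds_zero).sub_const c
    rw [zero_sub] at h0
    refine h0.congr' ?_
    filter_upwards [hev] with t ht
    have hu : 0 < 1 - t := by linarith [ht.2]
    have hp : 0 < (1 - t) ^ (ρ - 1) := Real.rpow_pos_of_pos hu _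
    have hs : (1 - t) ^ ρ = (1 - t) * (1 - t) ^ (ρ - 1) := by
      rw [← Real.rpow_one_add' hu.le (by linarith)]; congr 1; ring
    rw [hs, hd]
    field_simp
    ring
  have hpow : Tendsto (fun t : ℝ => (1 - t) ^ (ρ - 1)) (𝓝[<] 1) (𝓝 0) := by
    have hcont : Continuous fun t : ℝ => (1 - t) ^ (ρ - 1) :=
      (continuous_const.sub continuous_id).rpow_const fun _ => Or.inr (by linarith)
    have := (hcont.tendsto 1).mono_left (nhdsWithin_le_nhds (s := Iio 1))
    simpa [Real.zero_rpow (show ρ - 1 ≠ 0 by linarith)] using this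
  have hratio : Tendsto (fun t => (1 - κ t) / (1 - t)) (𝓝[<] 1) (𝓝[≠] 1) := by
    refine tendsto_nhdsWithin_iff.2 ⟨?_, ?_⟩
    · have := (hquot.mul hpow).const_add 1
      rw [mul_zero, add_zero] at this
      refine this.congr' ?_
      filter_upwards [hev] with t ht
      have hp : 0 < (1 - t) ^ (ρ - 1) := Real.rpow_pos_of_pos (by linarith [ht.2]) _
      rw [div_mul_cancel₀ _ hp.ne']
      ring
    · filter_upwards [hev] with t ht
      have := hκ.lt_map hd (by linarith [ht.1]) ht.2
      have hu : 0 < 1 - t := by linarith [ht.2]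
      exact ((div_lt_one hu).2 (by linarith)).ne
  have hslope : Tendsto (slope (fun x : ℝ => x ^ (-(ρ - 1))) 1) (𝓝[≠] 1) (𝓝 (-(ρ - 1))) := by
    have := Real.hasDerivAt_rpow_const (x := 1) (p := -(ρ - 1)) (Or.inl one_ne_zero)
    rw [Real.one_rpow, mul_one] at this
    exact hasDerivAt_iff_tendsto_slope.1 this
  have := (hslope.comp hratio).mul hquot
  rw [neg_mul_neg] at this
  refine this.congr' ?_
  filter_upwards [hev, hratio.eventually_mem self_mem_nhdsWithin] with t ht hne
  have hu : 0 < 1 - t := by linarith [ht.2]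
  have hκ1 : 0 ≤ 1 - κ t := by
    linarith [(hκ.mapsTo ⟨by linarith [ht.1], ht.2.le⟩ : κ t ∈ Icc (-1 : ℝ) 1).2]
  have hp : 0 < (1 - t) ^ (ρ - 1) := Real.rpow_pos_of_pos hu _
  have hne' : (1 - κ t) / (1 - t) - 1 ≠ 0 := sub_ne_zero.2 hne
  rw [Function.comp_apply, slope_def_field, Real.one_rpow, Real.div_rpow hκ1 hu.le,
    Real.rpow_neg hu.le]
  rw [div_mul_div_comm, mul_comm (_ - 1) ((1 - κ t) / (1 - t) - 1), mul_div_mul_left _ _ hne']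
  field_simp

/-- The common value `(c (ρ - 1)) ^ (-1 / (ρ - 1))` of the limit profile away from the points where
`κ = 1`. -/
def profileConst (c ρ : ℝ) : ℝ := ((ρ - 1) * c) ^ (-(1 / (ρ - 1)))

/-- The limit of `L ^ (1 / (ρ - 1)) * (1 - κ^[L] t)`. It vanishes where `κ t = 1`, that is at
`t = 1` and, for an even kernel, also at `t = -1`; elsewhere it is a positive constant. -/
def profile (κ : ℝ → ℝ) (c ρ : ℝ) (t : ℝ) : ℝ :=
  open Classical in if κ t = 1 then 0 else profileConst c ρ

theorem profileConst_pos (hκ : IsKernel κ) (hd : derivOne κ = 1) (hA : CovRegular κ c ρ) :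
    0 < profileConst c ρ :=
  Real.rpow_pos_of_pos (mul_pos (by linarith [hA.2.1]) (hA.pos hκ hd)) _

theorem profile_one (hκ : IsKernel κ) : profile κ c ρ 1 = 0 := by
  simp [profile, hκ.map_one]

theorem profile_of_mem_Ioo (hκ : IsKernel κ) {t : ℝ} (ht : t ∈ Ioo (-1 : ℝ) 1) :
    profile κ c ρ t = profileConst c ρ := by
  simp [profile, (hκ.lt_one ht).ne]

theorem tendsto_profile (hκ : IsKernel κ) (hd : derivOne κ = 1) (hA : CovRegular κ c ρ)
    {t : ℝ} (ht : t ∈ Icc (-1 : ℝ) 1) :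
    Tendsto (fun L : ℕ => speed ρ L * (1 - κ^[L] t)) atTop (𝓝 (profile κ c ρ t)) := by
  by_cases h1 : κ t = 1
  · rw [profile, if_pos h1]
    refine tendsto_const_nhds.congr' ?_
    filter_upwards [eventually_ge_atTop 1] with L hL
    obtain ⟨n, rfl⟩ := Nat.exists_eq_add_of_le' hL
    rw [Function.iterate_succ_apply, h1, hκ.iterate_one, sub_self, mul_zero]
  rw [profile, if_neg h1, profileConst]
  have hρ : 0 < ρ - 1 := by linarith [hA.2.1]
  have hlt : ∀ L : ℕ, 1 ≤ L → κ^[L] t < 1 := by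
    intro L hL
    obtain ⟨n, rfl⟩ := Nat.exists_eq_add_of_le' hL
    rw [Function.iterate_succ_apply]
    have ht1 : t < 1 := lt_of_le_of_ne ht.2 fun h => h1 (h ▸ hκ.map_one)
    exact (hκ.iterate_mem_Ioo hd ⟨ht.1.trans_lt (hκ.lt_map hd ht.1 ht1),
      lt_of_le_of_ne (hκ.mapsTo ht).2 h1⟩ n).2
  have hto : Tendsto (fun L => κ^[L] t) atTop (𝓝[<] 1) :=
    tendsto_nhdsWithin_iff.2 ⟨hκ.tendsto_iterate hd ht,
      (eventually_ge_atTop 1).mono fun L hL => hlt L hL⟩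
  set w : ℕ → ℝ := fun L => (1 - κ^[L] t) ^ (-(ρ - 1)) with hw
  have hinc : Tendsto (fun L => w (L + 1) - w L) atTop (𝓝 ((ρ - 1) * c)) := by
    have := (tendsto_rpow_increment hκ hd hA).comp hto
    simpa only [hw, Function.iterate_succ_apply'] using! this
  have hces := hinc.cesaro
  simp only [Finset.sum_range_sub] at hces
  have hdiv : Tendsto (fun L : ℕ => w L / L) atTop (𝓝 ((ρ - 1) * c)) := by
    have h0 : Tendsto (fun n : ℕ => (n : ℝ)⁻¹ * w 0) atTop (𝓝 0) := by
      simpa using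
        (tendsto_inv_atTop_zero.comp (tendsto_natCast_atTop_atTop (R := ℝ))).mul_const (w 0)
    have := hces.add h0
    rw [add_zero] at this
    refine this.congr fun n => ?_
    rw [div_eq_inv_mul]
    ring
  have hpos : 0 < (ρ - 1) * c := mul_pos hρ (hA.pos hκ hd)
  refine (hdiv.rpow_const (Or.inl hpos.ne') (p := -(1 / (ρ - 1)))).congr' ?_
  filter_upwards [eventually_ge_atTop 1] with L hL
  have hu : 0 ≤ 1 - κ^[L] t := by linarith [hlt L hL]
  rw [hw, Real.div_rpow (by positivity) (by positivity), ← Real.rpow_mul hu,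
    Real.rpow_neg (Nat.cast_nonneg L), speed, div_inv_eq_mul, mul_comm]
  rw [show -(ρ - 1) * -(1 / (ρ - 1)) = 1 by field_simp, Real.rpow_one]

/-- The rescaled iterates are bounded uniformly on `[-1, 1]`. -/
theorem exists_profile_bound (hκ : IsKernel κ) (hd : derivOne κ = 1) (hA : CovRegular κ c ρ) :
    ∃ C : ℝ, ∀ᶠ L : ℕ in atTop, ∀ t ∈ Icc (-1 : ℝ) 1, |speed ρ L * (1 - κ^[L] t)| ≤ C := by
  obtain ⟨n, hn⟩ := hκ.exists_iterate_zero_le hd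
  have hρ : 0 < ρ - 1 := by linarith [hA.2.1]
  obtain ⟨M, hM⟩ := (tendsto_profile hκ hd hA (t := 0) (by norm_num)).bddAbove_range
  refine ⟨((n : ℝ) + 1) ^ (1 / (ρ - 1)) * M, ?_⟩
  filter_upwards [eventually_ge_atTop (n + 1)] with L hL t ht
  obtain ⟨k, rfl⟩ := Nat.exists_eq_add_of_le' hL
  have hsp : speed ρ (k + (n + 1)) ≤ ((n : ℝ) + 1) ^ (1 / (ρ - 1)) * speed ρ (k + 1) := by
    rw [speed, speed, ← Real.mul_rpow (by positivity) (by positivity)]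
    refine Real.rpow_le_rpow (by positivity) ?_ (by positivity)
    push_cast
    nlinarith [(Nat.cast_nonneg k : (0 : ℝ) ≤ k), (Nat.cast_nonneg n : (0 : ℝ) ≤ n),
      mul_nonneg (Nat.cast_nonneg k : (0 : ℝ) ≤ k) (Nat.cast_nonneg n : (0 : ℝ) ≤ n)]
  have h0 : 0 ≤ speed ρ (k + (n + 1)) := by rw [speed]; positivity
  have hle : 1 - κ^[k + (n + 1)] t ≤ 1 - κ^[k + 1] 0 := by
    have := hn t ht (k + 1)
    rw [show k + 1 + n = k + (n + 1) by ring] at this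
    linarith
  have hu : 0 ≤ 1 - κ^[k + (n + 1)] t := by linarith [(hκ.iterate_mem ht (k + (n + 1))).2]
  rw [abs_of_nonneg (mul_nonneg h0 hu)]
  calc speed ρ (k + (n + 1)) * (1 - κ^[k + (n + 1)] t)
      ≤ (((n : ℝ) + 1) ^ (1 / (ρ - 1)) * speed ρ (k + 1)) * (1 - κ^[k + 1] 0) :=
        mul_le_mul hsp hle hu (h0.trans hsp)
    _ = ((n : ℝ) + 1) ^ (1 / (ρ - 1)) * (speed ρ (k + 1) * (1 - κ^[k + 1] 0)) := by ring
    _ ≤ _ := mul_le_mul_of_nonneg_left (hM (mem_range_self (k + 1))) (by positivity)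

end Rate


/-! ### Points of the sphere -/

section Sphere

variable {d : ℕ}

theorem norm_coe_sph (x : Sph d) : ‖(x : EuclideanSpace ℝ (Fin (d + 1)))‖ = 1 := by simp

theorem sdot_comm (x y : Sph d) : sdot x y = sdot y x := real_inner_comm _ _

theorem sdot_self (x : Sph d) : sdot x x = 1 := by
  rw [sdot, real_inner_self_eq_norm_sq, norm_coe_sph, one_pow]

theorem sdot_mem_Icc (x y : Sph d) : sdot x y ∈ Icc (-1 : ℝ) 1 := by
  have := abs_real_inner_le_norm (x : EuclideanSpace ℝ (Fin (d + 1))) y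
  rw [norm_coe_sph, norm_coe_sph, one_mul] at this
  exact abs_le.1 this

theorem sdot_eq_one_iff {x y : Sph d} : sdot x y = 1 ↔ x = y := by
  rw [sdot, inner_eq_one_iff_of_norm_eq_one (norm_coe_sph x) (norm_coe_sph y), Subtype.ext_iff]

theorem sdot_neg_right (x y : Sph d) : sdot x (-y) = -sdot x y := by
  simp [sdot]

theorem sdot_mem_Ioo {x y : Sph d} (h : x ≠ y) (h' : x ≠ -y) : sdot x y ∈ Ioo (-1 : ℝ) 1 := by
  refine ⟨lt_of_le_of_ne (sdot_mem_Icc x y).1 fun heq => h' ?_,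
    lt_of_le_of_ne (sdot_mem_Icc x y).2 fun heq => h (sdot_eq_one_iff.1 heq)⟩
  rw [← sdot_eq_one_iff, sdot_neg_right, ← heq, neg_neg]

theorem continuous_sdot : Continuous fun p : Sph d × Sph d => sdot p.1 p.2 := by
  unfold sdot
  fun_prop

theorem ne_neg_of_dist_lt_one {p x y : Sph d} (hx : dist x p < 1) (hy : dist y p < 1) :
    x ≠ -y := by
  rintro rfl
  have h1 : dist (-y) y = 2 := by
    rw [Subtype.dist_eq, dist_eq_norm]
    have : ((-y : Sph d) : EuclideanSpace ℝ (Fin (d + 1))) - y = (-2 : ℝ) • (y : _) := by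
      rw [coe_neg_sphere, neg_smul, two_smul]
      abel
    rw [this, norm_smul, norm_coe_sph]
    norm_num
  linarith [dist_triangle_right (-y) y p]

theorem infinite_of_mem_nhds_sph (hd : 1 ≤ d) {p : Sph d} {U : Set (Sph d)} (hU : U ∈ 𝓝 p) :
    U.Infinite := by
  have hrank : 1 < Module.rank ℝ (EuclideanSpace ℝ (Fin (d + 1))) := by
    rw [← Module.finrank_eq_rank, finrank_euclideanSpace_fin]
    exact_mod_cast Nat.lt_succ_of_le hd
  have : ConnectedSpace (Sph d) :=
    isConnected_iff_connectedSpace.1 (isConnected_sphere hrank 0 zero_le_one)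
  have : Nontrivial (Sph d) :=
    ⟨p, -p, ne_neg_of_dist_lt_one (p := p) (by simp) (by simp)⟩
  exact infinite_of_mem_nhds p hU

/-- Arbitrarily many points close to `p` where `f` is close to `f p`, off a given finite set. -/
theorem exists_finset_near (hd : 1 ≤ d) (f : C(Sph d, ℝ)) (p : Sph d) {ε : ℝ} (hε : 0 < ε)
    (F : Finset (Sph d)) (K : ℕ) :
    ∃ A : Finset (Sph d), A.card = K ∧
      ∀ x ∈ A, |f x - f p| < ε ∧ dist x p < 1 ∧ x ∉ F := by
  have h1 : ∀ᶠ x in 𝓝 p, |f x - f p| < ε :=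
    (Metric.tendsto_nhds.1 f.continuous.continuousAt) ε hε
  have h2 : ∀ᶠ x in 𝓝 p, dist x p < 1 := Metric.ball_mem_nhds p one_pos
  have hinf := (infinite_of_mem_nhds_sph hd (h1.and h2)).sdiff F.finite_toSet
  obtain ⟨A, hA, hcard⟩ := hinf.exists_subset_card_eq K
  exact ⟨A, hcard, fun x hx => ⟨(hA hx).1.1, (hA hx).1.2, (hA hx).2⟩⟩

end Sphere

/-! ### Divergence of the functional rate functions -/

section Rates

variable {d : ℕ}

/-- The functional rate function dominates every quadratic expression with finitely supported
weights. -/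
theorem le_supRate {b : Sph d → Sph d → ℝ} (f : C(Sph d, ℝ)) {A : Finset (Sph d)}
    (hA : A.Nonempty) (w : Sph d → ℝ) :
    ((∑ x ∈ A, w x * f x - 1 / 2 * ∑ x ∈ A, ∑ y ∈ A, w x * w y * b x y : ℝ) : EReal) ≤
      supRate (fun {m} (x : Fin m → Sph d) => Matrix.of fun i j => b (x i) (x j)) f := by
  have hsum (g : Sph d → ℝ) : ∑ x ∈ A, g x = ∑ i, g (A.equivFin.symm i) := by
    rw [← Finset.sum_coe_sort, ← A.equivFin.symm.sum_comp]
  refine le_iSup_of_le A.card <| le_iSup_of_le hA.card_pos <|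
    le_iSup_of_le (fun i => (A.equivFin.symm i : Sph d)) <|
    le_iSup_of_le (Subtype.val_injective.comp A.equivFin.symm.injective) <|
    le_iSup_of_le (fun i => w (A.equivFin.symm i)) (le_of_eq ?_)
  congr 1
  simp only [dotProduct, Matrix.mulVec, Matrix.of_apply, hsum, Finset.mul_sum]
  congr 1
  refine Finset.sum_congr rfl fun i _ => Finset.sum_congr rfl fun j _ => ?_
  ring

theorem eq_top_of_forall_nat_mul_le {x : EReal} {r : ℝ} (hr : 0 < r)
    (h : ∀ K : ℕ, ((((K + 1 : ℕ) : ℝ) * r : ℝ) : EReal) ≤ x) : x = ⊤ := by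
  rw [EReal.eq_top_iff_forall_lt]
  intro y
  obtain ⟨K, hK⟩ := exists_nat_gt (y / r)
  refine lt_of_lt_of_le (EReal.coe_lt_coe_iff.2 ?_) (h K)
  rw [div_lt_iff₀ hr] at hK
  push_cast
  linarith

/-- On finite sets without antipodal pairs a profile `S` that is `0` at `1` and equal to `s` on
`(-1, 1)` has a quadratic form which is a rank-one term minus `s` times the sum of squares: on
weights of total mass zero, `-S` is the covariance of a white noise. -/
theorem sum_mul_profile {S : ℝ → ℝ} {s : ℝ} (h1 : S 1 = 0) (hS : ∀ t ∈ Ioo (-1 : ℝ) 1, S t = s)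
    {A : Finset (Sph d)} (hA : ∀ x ∈ A, ∀ y ∈ A, x ≠ -y) (w : Sph d → ℝ) :
    ∑ x ∈ A, ∑ y ∈ A, w x * w y * S (sdot x y) =
      s * (∑ x ∈ A, w x) ^ 2 - s * ∑ x ∈ A, w x ^ 2 := by
  classical
  have hterm (x : Sph d) (hx : x ∈ A) :
      ∑ y ∈ A, w x * w y * S (sdot x y) = s * (w x * ∑ y ∈ A, w y) - s * w x ^ 2 := by
    have : ∀ y ∈ A, w x * w y * S (sdot x y) =
        s * (w x * w y) - if x = y then s * (w x * w y) else 0 := by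
      intro y hy
      split_ifs with hxy
      · rw [hxy, sdot_self, h1]; ring
      · rw [hS _ (sdot_mem_Ioo hxy (hA x hx y hy))]; ring
    rw [Finset.sum_congr rfl this, Finset.sum_sub_distrib, Finset.sum_ite_eq, if_pos hx,
      Finset.mul_sum, Finset.mul_sum]
    ring
  rw [Finset.sum_congr rfl hterm, Finset.sum_sub_distrib, ← Finset.mul_sum, ← Finset.mul_sum,
    ← Finset.sum_mul]
  ring

/-- If the covariance acts on weights of total mass zero as `s` times the identity, then a
continuous function taking two different values has infinite rate: opposite weights on `K` points
near each of the two values give a contribution of order `K`. -/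
theorem supRate_eq_top_of_ne (hd : 1 ≤ d) {b : Sph d → Sph d → ℝ} {s : ℝ} (hs : 0 < s)
    (hb : ∀ A : Finset (Sph d), (∀ x ∈ A, ∀ y ∈ A, x ≠ -y) → ∀ w : Sph d → ℝ,
      ∑ x ∈ A, w x = 0 → ∑ x ∈ A, ∑ y ∈ A, w x * w y * b x y = s * ∑ x ∈ A, w x ^ 2)
    {f : C(Sph d, ℝ)} {p q : Sph d} (hpq : f q < f p) :
    supRate (fun {m} (x : Fin m → Sph d) => Matrix.of fun i j => b (x i) (x j)) f = ⊤ := by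
  classical
  set Δ := f p - f q with hΔ
  have hΔ0 : 0 < Δ := sub_pos.2 hpq
  refine eq_top_of_forall_nat_mul_le (r := Δ ^ 2 / (16 * s)) (by positivity) fun K => ?_
  obtain ⟨A, hAc, hA⟩ := exists_finset_near hd f p (ε := Δ / 4) (by positivity) ∅ (K + 1)
  obtain ⟨B, hBc, hB⟩ := exists_finset_near hd f q (ε := Δ / 4) (by positivity)
    (A ∪ A.image (fun x => -x)) (K + 1)
  have hAB : Disjoint A B := Finset.disjoint_right.2 fun x hx hxA =>
    (hB x hx).2.2 (Finset.mem_union_left _ hxA)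
  have hcross {x y : Sph d} (hx : x ∈ A) (hy : y ∈ B) : x ≠ -y := fun h =>
    (hB y hy).2.2 (Finset.mem_union_right _
      (Finset.mem_image.2 ⟨x, hx, by rw [h, neg_neg]⟩))
  have hanti : ∀ x ∈ A ∪ B, ∀ y ∈ A ∪ B, x ≠ -y := by
    intro x hx y hy
    rcases Finset.mem_union.1 hx with hx | hx <;> rcases Finset.mem_union.1 hy with hy | hy
    · exact ne_neg_of_dist_lt_one (hA x hx).2.1 (hA y hy).2.1
    · exact hcross hx hy
    · exact fun h => hcross hy hx (by rw [h, neg_neg])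
    · exact ne_neg_of_dist_lt_one (hB x hx).2.1 (hB y hy).2.1
  set η := Δ / (4 * s) with hη
  have hη0 : 0 < η := by positivity
  set w : Sph d → ℝ := fun x => if x ∈ A then η else -η with hw
  have hwA : ∀ x ∈ A, w x = η := fun x hx => if_pos hx
  have hwB : ∀ x ∈ B, w x = -η := fun x hx => if_neg (Finset.disjoint_right.1 hAB hx)
  have hAne : (A ∪ B).Nonempty :=
    (Finset.card_pos.1 (by omega : 0 < A.card)).mono Finset.subset_union_left
  refine le_trans (EReal.coe_le_coe_iff.2 ?_) (le_supRate f hAne w)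
  have hw0 : ∑ x ∈ A ∪ B, w x = 0 := by
    rw [Finset.sum_union hAB, Finset.sum_congr rfl hwA, Finset.sum_congr rfl hwB]
    simp [hAc, hBc]
  have hw2 : ∑ x ∈ A ∪ B, w x ^ 2 = 2 * ((K + 1 : ℕ) : ℝ) * η ^ 2 := by
    have : ∀ x ∈ A ∪ B, w x ^ 2 = η ^ 2 := fun x _ => by
      simp only [hw]; split_ifs <;> ring
    rw [Finset.sum_congr rfl this, Finset.sum_const, Finset.card_union_of_disjoint hAB, hAc, hBc,
      nsmul_eq_mul]
    push_cast
    ring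
  rw [hb _ hanti w hw0, hw2, Finset.sum_union hAB]
  have hsA : ((K + 1 : ℕ) : ℝ) * (η * (f p - Δ / 4)) ≤ ∑ x ∈ A, w x * f x := by
    rw [← hAc, ← nsmul_eq_mul]
    refine Finset.card_nsmul_le_sum _ _ _ fun x hx => ?_
    rw [hwA x hx]
    exact mul_le_mul_of_nonneg_left (by linarith [(abs_lt.1 (hA x hx).1).1]) hη0.le
  have hsB : ((K + 1 : ℕ) : ℝ) * (-η * (f q + Δ / 4)) ≤ ∑ x ∈ B, w x * f x := by
    rw [← hBc, ← nsmul_eq_mul]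
    refine Finset.card_nsmul_le_sum _ _ _ fun x hx => ?_
    rw [hwB x hx]
    exact mul_le_mul_of_nonpos_left (by linarith [(abs_lt.1 (hB x hx).1).2]) (by linarith)
  have hval : Δ ^ 2 / (16 * s) = η * (Δ / 2) - s * η ^ 2 := by
    rw [hη]; field_simp; ring
  rw [hval]
  have : ((K + 1 : ℕ) : ℝ) * (η * (Δ / 2) - s * η ^ 2) =
      ((K + 1 : ℕ) : ℝ) * (η * (f p - Δ / 4)) + ((K + 1 : ℕ) : ℝ) * (-η * (f q + Δ / 4)) -
        1 / 2 * (s * (2 * ((K + 1 : ℕ) : ℝ) * η ^ 2)) := by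
    rw [hΔ]; ring
  linarith

/-- If the covariance is a multiple of the identity on finite sets without antipodal pairs, then a
non-zero continuous function has infinite rate. -/
theorem supRate_eq_top_of_ne_zero (hd : 1 ≤ d) {b : Sph d → Sph d → ℝ} {s : ℝ} (hs : 0 < s)
    (hb : ∀ A : Finset (Sph d), (∀ x ∈ A, ∀ y ∈ A, x ≠ -y) → ∀ w : Sph d → ℝ,
      ∑ x ∈ A, ∑ y ∈ A, w x * w y * b x y = s * ∑ x ∈ A, w x ^ 2)
    {f : C(Sph d, ℝ)} (hf : f ≠ 0) :
    supRate (fun {m} (x : Fin m → Sph d) => Matrix.of fun i j => b (x i) (x j)) f = ⊤ := by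
  obtain ⟨p, hp⟩ : ∃ p, f p ≠ 0 := by
    by_contra! h
    exact hf (ContinuousMap.ext h)
  have hp2 : 0 < f p ^ 2 := by positivity
  refine eq_top_of_forall_nat_mul_le (r := f p ^ 2 / (8 * s)) (by positivity) fun K => ?_
  obtain ⟨A, hAc, hA⟩ := exists_finset_near hd f p (ε := |f p| / 2) (by positivity) ∅ (K + 1)
  refine le_trans (EReal.coe_le_coe_iff.2 ?_)
    (le_supRate f (Finset.card_pos.1 (by omega : 0 < A.card)) fun _ => f p / (2 * s))
  rw [hb A (fun x hx y hy => ne_neg_of_dist_lt_one (hA x hx).2.1 (hA y hy).2.1), Finset.sum_const,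
    hAc, nsmul_eq_mul]
  have hsum : ((K + 1 : ℕ) : ℝ) * (f p ^ 2 / (4 * s)) ≤ ∑ x ∈ A, f p / (2 * s) * f x := by
    rw [← hAc, ← nsmul_eq_mul]
    refine Finset.card_nsmul_le_sum _ _ _ fun x hx => ?_
    have hclose := (hA x hx).1
    have : f p ^ 2 / 2 ≤ f p * f x := by
      have h1 : |f p * (f x - f p)| ≤ |f p| * (|f p| / 2) := by
        rw [abs_mul]; gcongr
      have h2 := (abs_le.1 h1).1
      nlinarith [abs_mul_abs_self (f p)]
    calc f p ^ 2 / (4 * s) = f p ^ 2 / 2 / (2 * s) := by ring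
      _ ≤ f p * f x / (2 * s) := by gcongr
      _ = _ := by ring
  have : ((K + 1 : ℕ) : ℝ) * (f p ^ 2 / (8 * s)) = ((K + 1 : ℕ) : ℝ) * (f p ^ 2 / (4 * s)) -
      1 / 2 * (s * (((K + 1 : ℕ) : ℝ) * (f p / (2 * s)) ^ 2)) := by
    field_simp; ring
  linarith

/-- A single point of positive variance has a finite marginal rate, so the marginals fail as soon as
the functional rate is infinite off the zero function. -/
theorem marginalsFail_of_supRate_eq_top {b : Sph d → Sph d → ℝ} {p : Sph d} (hp : 0 < b p p)
    (hb : ∀ f : C(Sph d, ℝ), f ≠ 0 →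
      supRate (fun {m} (x : Fin m → Sph d) => Matrix.of fun i j => b (x i) (x j)) f = ⊤) :
    MarginalsFail fun {m} (x : Fin m → Sph d) => Matrix.of fun i j => b (x i) (x j) := by
  refine ⟨1, fun _ => p, fun _ => 1, le_rfl, Function.injective_of_subsingleton _, ?_, ?_⟩
  · refine lt_of_le_of_lt (iSup_le fun θ => ?_) (EReal.coe_lt_top (1 / (2 * b p p)))
    refine EReal.coe_le_coe_iff.2 ?_
    simp only [dotProduct, Matrix.mulVec, Matrix.of_apply, Finset.univ_unique, Finset.sum_singleton]
    rw [le_div_iff₀ (by positivity)]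
    nlinarith [sq_nonneg (θ default * b p p - 1)]
  · refine iInf₂_eq_top.2 fun f hf => hb f ?_
    rintro rfl
    exact zero_ne_one (hf 0)

variable {S : ℝ → ℝ} {s : ℝ}

theorem sum_mul_B₁ (h1 : S 1 = 0) (hS : ∀ t ∈ Ioo (-1 : ℝ) 1, S t = s) (A : Finset (Sph d))
    (hA : ∀ x ∈ A, ∀ y ∈ A, x ≠ -y) (w : Sph d → ℝ) (hw : ∑ x ∈ A, w x = 0) :
    ∑ x ∈ A, ∑ y ∈ A, w x * w y *
      (S (sdot x (northPole d)) + S (sdot y (northPole d)) - S (sdot x y)) =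
        s * ∑ x ∈ A, w x ^ 2 := by
  have h := sum_mul_profile h1 hS hA w
  have hsplit (x : Sph d) : ∑ y ∈ A, w x * w y *
      (S (sdot x (northPole d)) + S (sdot y (northPole d)) - S (sdot x y)) =
      w x * S (sdot x (northPole d)) * ∑ y ∈ A, w y +
        w x * ∑ y ∈ A, w y * S (sdot y (northPole d)) - ∑ y ∈ A, w x * w y * S (sdot x y) := by
    rw [Finset.mul_sum, Finset.mul_sum, ← Finset.sum_add_distrib, ← Finset.sum_sub_distrib]
    exact Finset.sum_congr rfl fun y _ => by ring
  rw [Finset.sum_congr rfl fun x _ => hsplit x, Finset.sum_sub_distrib, Finset.sum_add_distrib,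
    ← Finset.sum_mul, ← Finset.sum_mul, h, hw]
  ring

theorem supRate_B₁_of_not_const (hd : 1 ≤ d) (hs : 0 < s) (h1 : S 1 = 0)
    (hS : ∀ t ∈ Ioo (-1 : ℝ) 1, S t = s) {f : C(Sph d, ℝ)} (hf : ¬ ∃ a : ℝ, ∀ x, f x = a) :
    supRate (B₁ S) f = ⊤ := by
  push Not at hf
  obtain ⟨x, hx⟩ := hf (f (northPole d))
  rcases hx.lt_or_gt with h | h
  all_goals exact supRate_eq_top_of_ne hd hs (sum_mul_B₁ h1 hS) h

/-- The centred field vanishes at the North Pole, so any function that does not vanish there has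
infinite rate; in particular so does any non-zero constant. -/
theorem supRate_B₁_of_ne_zero (hd : 1 ≤ d) (hs : 0 < s) (h1 : S 1 = 0)
    (hS : ∀ t ∈ Ioo (-1 : ℝ) 1, S t = s) {f : C(Sph d, ℝ)} (hf : f ≠ 0) :
    supRate (B₁ S) f = ⊤ := by
  by_cases hc : ∃ a : ℝ, ∀ x, f x = a
  · obtain ⟨a, ha⟩ := hc
    have ha0 : a ≠ 0 := by
      rintro rfl
      exact hf (ContinuousMap.ext ha)
    refine eq_top_of_forall_nat_mul_le (r := 1) one_pos fun K => ?_
    have := le_supRate (b := fun x y => S (sdot x (northPole d)) + S (sdot y (northPole d)) -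
      S (sdot x y)) f (Finset.singleton_nonempty (northPole d)) fun _ => ((K + 1 : ℕ) : ℝ) / a
    refine le_trans (EReal.coe_le_coe_iff.2 (le_of_eq ?_)) this
    simp only [Finset.sum_singleton, sdot_self, h1, ha]
    field_simp
    ring
  · exact supRate_B₁_of_not_const hd hs h1 hS hc

/-- Away from the poles the limiting variance of the field centred at the North Pole is positive. -/
theorem exists_B₁_pos (hd : 1 ≤ d) (hs : 0 < s) (h1 : S 1 = 0)
    (hS : ∀ t ∈ Ioo (-1 : ℝ) 1, S t = s) :
    ∃ p : Sph d, 0 < S (sdot p (northPole d)) + S (sdot p (northPole d)) - S (sdot p p) := by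
  obtain ⟨p, -, hp⟩ := ((infinite_of_mem_nhds_sph hd (univ_mem (f := 𝓝 (northPole d)))).sdiff
    (toFinite {northPole d, -northPole d})).nonempty
  simp only [mem_insert_iff, mem_singleton_iff, not_or] at hp
  refine ⟨p, ?_⟩
  rw [hS _ (sdot_mem_Ioo hp.1 hp.2), sdot_self, h1]
  linarith

theorem marginalsFail_B₁ (hd : 1 ≤ d) (hs : 0 < s) (h1 : S 1 = 0)
    (hS : ∀ t ∈ Ioo (-1 : ℝ) 1, S t = s) : MarginalsFail (d := d) (B₁ S) := by
  obtain ⟨p, hp⟩ := exists_B₁_pos (d := d) hd hs h1 hS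
  exact marginalsFail_of_supRate_eq_top (p := p) (b := fun x y =>
    S (sdot x (northPole d)) + S (sdot y (northPole d)) - S (sdot x y)) hp fun f hf =>
    supRate_B₁_of_ne_zero hd hs h1 hS hf

theorem weight_integral_pos (hd : 1 ≤ d) :
    0 < ∫ t in (-1 : ℝ)..1, (1 - t ^ 2) ^ ((d : ℝ) / 2 - 1) := by
  have hd' : (1 : ℝ) ≤ d := by exact_mod_cast hd
  have hpos {t : ℝ} (ht : t ∈ Ioo (-1 : ℝ) 1) : 0 < 1 - t ^ 2 := by nlinarith [ht.1, ht.2]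
  refine intervalIntegral.intervalIntegral_pos_of_pos_on ?_
    (fun t ht => Real.rpow_pos_of_pos (hpos ht) _) (by norm_num)
  -- the exponent is at least `-1/2`, so the weight is bounded by the derivative of `arcsin`
  have hg := Polynomial.Chebyshev.intervalIntegrable_sqrt_one_sub_sq_inv
  rw [intervalIntegrable_iff, uIoc_of_le (by norm_num), integrableOn_Ioc_iff_integrableOn_Ioo]
    at hg ⊢
  refine hg.mono' (Measurable.pow_const (by fun_prop) _).aestronglyMeasurable
    ((ae_restrict_iff' measurableSet_Ioo).2 (Eventually.of_forall fun t ht => ?_))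
  have h := hpos ht
  rw [Real.norm_of_nonneg (Real.rpow_pos_of_pos h _).le, Real.sqrt_inv, Real.sqrt_eq_rpow,
    ← Real.rpow_neg h.le]
  exact Real.rpow_le_rpow_of_exponent_ge h (by nlinarith) (by linarith)

/-- The weighted mean of the profile is its constant value `s` on `(-1, 1)`. -/
theorem B₂_eq (hd : 1 ≤ d) (hS : ∀ t ∈ Ioo (-1 : ℝ) 1, S t = s) {m : ℕ} (x : Fin m → Sph d) :
    B₂ S x = Matrix.of fun i j => s - S (sdot (x i) (x j)) := by
  have hint : ∫ t in (-1 : ℝ)..1, S t * (1 - t ^ 2) ^ ((d : ℝ) / 2 - 1) =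
      s * ∫ t in (-1 : ℝ)..1, (1 - t ^ 2) ^ ((d : ℝ) / 2 - 1) := by
    rw [← intervalIntegral.integral_const_mul]
    simp only [intervalIntegral.integral_of_le (show (-1 : ℝ) ≤ 1 by norm_num),
      integral_Ioc_eq_integral_Ioo]
    exact setIntegral_congr_fun measurableSet_Ioo fun t ht => by
      simp only [hS t ht]
  rw [B₂, hint, mul_div_cancel_right₀ _ (weight_integral_pos hd).ne']

theorem sum_mul_B₂ (h1 : S 1 = 0) (hS : ∀ t ∈ Ioo (-1 : ℝ) 1, S t = s) (A : Finset (Sph d))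
    (hA : ∀ x ∈ A, ∀ y ∈ A, x ≠ -y) (w : Sph d → ℝ) :
    ∑ x ∈ A, ∑ y ∈ A, w x * w y * (s - S (sdot x y)) = s * ∑ x ∈ A, w x ^ 2 := by
  have h := sum_mul_profile h1 hS hA w
  have h2 : ∑ x ∈ A, ∑ y ∈ A, w x * w y * s = s * (∑ x ∈ A, w x) ^ 2 := by
    simp only [← Finset.sum_mul]
    rw [sq, Finset.sum_mul_sum, mul_comm]
  simp only [mul_sub, Finset.sum_sub_distrib]
  rw [h, h2]
  ring

theorem B₂_eq_fun (hd : 1 ≤ d) (hS : ∀ t ∈ Ioo (-1 : ℝ) 1, S t = s) :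
    (@B₂ d S) = fun {m} (x : Fin m → Sph d) => Matrix.of fun i j => s - S (sdot (x i) (x j)) := by
  funext m x
  exact B₂_eq hd hS x

theorem supRate_B₂_of_ne_zero (hd : 1 ≤ d) (hs : 0 < s) (h1 : S 1 = 0)
    (hS : ∀ t ∈ Ioo (-1 : ℝ) 1, S t = s) {f : C(Sph d, ℝ)} (hf : f ≠ 0) :
    supRate (B₂ S) f = ⊤ := by
  rw [B₂_eq_fun hd hS]
  exact supRate_eq_top_of_ne_zero hd hs (sum_mul_B₂ h1 hS) hf

theorem marginalsFail_B₂ (hd : 1 ≤ d) (hs : 0 < s) (h1 : S 1 = 0)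
    (hS : ∀ t ∈ Ioo (-1 : ℝ) 1, S t = s) : MarginalsFail (d := d) (B₂ S) := by
  rw [B₂_eq_fun hd hS]
  refine marginalsFail_of_supRate_eq_top (p := northPole d) (b := fun x y => s - S (sdot x y)) ?_
    fun f hf => supRate_eq_top_of_ne_zero hd hs (sum_mul_B₂ h1 hS) hf
  rw [sdot_self, h1]
  linarith

end Rates


/-! ### Gaussian laws of centred linear functionals -/

section Gaussian

variable {Ω : Type*} [MeasurableSpace Ω] {P : Measure Ω} [IsProbabilityMeasure P] {d : ℕ}

/-- `Y` has the centred normal law with variance `V`. -/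
def IsCentredGaussian (Y : Ω → ℝ) (V : ℝ) (P : Measure Ω) : Prop :=
  0 ≤ V ∧ HasLaw Y (gaussianReal 0 V.toNNReal) P

/-- An everywhere limit of centred Gaussian variables with converging variances is Gaussian. -/
theorem IsCentredGaussian.of_tendsto {Z : ℕ → Ω → ℝ} {Y : Ω → ℝ} {V : ℕ → ℝ} {v : ℝ}
    (hG : ∀ n, IsCentredGaussian (Z n) (V n) P)
    (hlim : ∀ ω, Tendsto (fun n => Z n ω) atTop (𝓝 (Y ω))) (hV : Tendsto V atTop (𝓝 v)) :
    IsCentredGaussian Y v P := by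
  have hZ (n : ℕ) := (hG n).2
  have hY : AEMeasurable Y P :=
    aemeasurable_of_tendsto_metrizable_ae' (fun n => (hZ n).aemeasurable)
      (Eventually.of_forall hlim)
  refine ⟨ge_of_tendsto' hV fun n => (hG n).1, hY, ?_⟩
  have : IsProbabilityMeasure (P.map Y) := Measure.isProbabilityMeasure_map hY
  refine Measure.ext_of_charFun (funext fun t => ?_)
  have hchar {W : Ω → ℝ} (hW : AEMeasurable W P) :
      charFun (P.map W) t = ∫ ω, Complex.exp (t * W ω * Complex.I) ∂P := by
    rw [charFun_apply_real, integral_map hW (by fun_prop)]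
  have h1 : Tendsto (fun n => charFun (P.map (Z n)) t) atTop (𝓝 (charFun (P.map Y) t)) := by
    rw [hchar hY]
    simp only [fun n => hchar (hZ n).aemeasurable]
    refine tendsto_integral_of_dominated_convergence (fun _ => 1) (fun n => ?_)
      (integrable_const _) (fun n => Eventually.of_forall fun ω => ?_)
      (Eventually.of_forall fun ω => ?_)
    · have := (hZ n).aemeasurable
      exact AEMeasurable.aestronglyMeasurable (by fun_prop)
    · rw [← Complex.ofReal_mul, Complex.norm_exp_ofReal_mul_I]
    · have hc : Continuous fun y : ℝ => Complex.exp (t * y * Complex.I) := by fun_prop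
      exact (hc.tendsto _).comp (hlim ω)
  have h2 : Tendsto (fun n => charFun (P.map (Z n)) t) atTop
      (𝓝 (charFun (gaussianReal 0 v.toNNReal) t)) := by
    simp only [fun n => (hZ n).map_eq, charFun_gaussianReal]
    have hc : Continuous fun u : ℝ =>
        Complex.exp (t * (0 : ℝ) * Complex.I - (u.toNNReal : ℝ) * t ^ 2 / 2) := by fun_prop
    exact (hc.tendsto v).comp hV
  exact tendsto_nhds_unique h1 h2

/-- Finite linear combinations of the values of an isotropic Gaussian field. -/
theorem IsIsotropicField.isCentredGaussian_sum {T : Ω → C(Sph d, ℝ)} {K : ℝ → ℝ}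
    (hT : IsIsotropicField P T K) {ι : Type*} [Fintype ι] (p : ι → Sph d) (w : ι → ℝ) :
    IsCentredGaussian (fun ω => ∑ i, w i * T ω (p i))
      (∑ i, ∑ j, w i * w j * K (sdot (p i) (p j))) P := by
  classical
  have hev (x : Sph d) : HasGaussianLaw (fun ω => T ω x) P := hT.gaussian.hasGaussianLaw_eval x
  have hL2 (i : ι) : MemLp (fun ω => w i * T ω (p i)) 2 P :=
    ((hev (p i)).memLp_two).const_mul (w i)
  have hgauss : HasGaussianLaw (fun ω => ∑ i, w i * T ω (p i)) P := by
    have h := hT.gaussian.hasGaussianLaw (Finset.univ.image p)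
    have hmem (i : ι) : p i ∈ Finset.univ.image p := Finset.mem_image_of_mem _ (Finset.mem_univ i)
    let ℓ : (↥(Finset.univ.image p) → ℝ) →L[ℝ] ℝ :=
      ∑ i, w i • ContinuousLinearMap.proj (R := ℝ)
        (⟨p i, hmem i⟩ : (Finset.univ.image p : Finset (Sph d)))
    have := h.map_fun ℓ
    simpa [ℓ, Finset.restrict] using this
  have hvar : Var[fun ω => ∑ i, w i * T ω (p i); P] =
      ∑ i, ∑ j, w i * w j * K (sdot (p i) (p j)) := by
    rw [← covariance_self hgauss.aemeasurable, covariance_fun_sum_fun_sum hL2 hL2]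
    refine Finset.sum_congr rfl fun i _ => Finset.sum_congr rfl fun j _ => ?_
    rw [covariance_const_mul_left, covariance_const_mul_right, hT.cov_eq]
    ring
  rw [← hvar]
  refine ⟨variance_nonneg _ _, hgauss.aemeasurable, ?_⟩
  rw [hgauss.map_eq_gaussianReal]
  congr 1
  · rw [integral_finsetSum _ fun i _ => (hL2 i).integrable (by norm_num)]
    simp [integral_const_mul, hT.centred]

/-- The variance of `∑ θ i * (T (x i) - ∫ T ∂μ)` for a field with covariance function `k`. -/
def centredVar (μ : Measure (Sph d)) (k : Sph d → Sph d → ℝ) {m : ℕ} (x : Fin m → Sph d)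
    (θ : Fin m → ℝ) : ℝ :=
  ∑ i, ∑ j, θ i * θ j * k (x i) (x j) - 2 * (∑ i, θ i) * ∑ i, θ i * ∫ y, k (x i) y ∂μ +
    (∑ i, θ i) ^ 2 * ∫ y, ∫ z, k y z ∂μ ∂μ

theorem integral_comp_simpleFunc (μ : Measure (Sph d)) [IsFiniteMeasure μ]
    (ψ : SimpleFunc (Sph d) (Sph d)) (g : Sph d → ℝ) :
    ∫ y, g (ψ y) ∂μ = ∑ z : ψ.range, μ.real (ψ ⁻¹' {(z : Sph d)}) * g z := by
  classical
  rw [Finset.sum_coe_sort ψ.range fun z => μ.real (ψ ⁻¹' {z}) * g z]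
  have h (y : Sph d) :
      g (ψ y) = ∑ z ∈ ψ.range, (ψ ⁻¹' {z}).indicator (fun _ => g z) y := by
    simp only [indicator_apply, mem_preimage, mem_singleton_iff]
    rw [Finset.sum_ite_eq, if_pos (ψ.mem_range_self y)]
  simp only [h]
  rw [integral_finsetSum _ fun z _ =>
    (integrable_const (g z)).indicator (ψ.measurableSet_preimage {z})]
  refine Finset.sum_congr rfl fun z _ => ?_
  rw [integral_indicator_const _ (ψ.measurableSet_preimage {z}), smul_eq_mul]

theorem tendsto_comp_sdot {K : ℝ → ℝ}
    (hk : Continuous fun q : Sph d × Sph d => K (sdot q.1 q.2)) {f g : ℕ → Sph d} {u v : Sph d}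
    (hf : Tendsto f atTop (𝓝 u)) (hg : Tendsto g atTop (𝓝 v)) :
    Tendsto (fun n => K (sdot (f n) (g n))) atTop (𝓝 (K (sdot u v))) := by
  have h2 : Tendsto (fun n => (f n, g n)) atTop (𝓝 (u, v)) := hf.prodMk_nhds hg
  have h := (hk.tendsto (u, v)).comp h2
  simpa only [Function.comp_def] using h

/-- The law of a centred linear functional when the mean over `μ` is replaced by its Riemann sum
along a simple function `ψ`. -/
theorem IsIsotropicField.isCentredGaussian_centred_simpleFunc {T : Ω → C(Sph d, ℝ)} {K : ℝ → ℝ}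
    (hT : IsIsotropicField P T K) (μ : Measure (Sph d)) [IsFiniteMeasure μ]
    (ψ : SimpleFunc (Sph d) (Sph d)) {m : ℕ} (x : Fin m → Sph d) (θ : Fin m → ℝ) :
    IsCentredGaussian (fun ω => ∑ i, θ i * (T ω (x i) - ∫ y, T ω (ψ y) ∂μ))
      (∑ i, ∑ j, θ i * θ j * K (sdot (x i) (x j)) -
        2 * (∑ i, θ i) * ∑ i, θ i * ∫ y, K (sdot (x i) (ψ y)) ∂μ +
          (∑ i, θ i) ^ 2 * ∫ y, ∫ z, K (sdot (ψ y) (ψ z)) ∂μ ∂μ) P := by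
  set s := ∑ i, θ i with hs
  let c : ψ.range → ℝ := fun z => μ.real (ψ ⁻¹' {(z : Sph d)})
  have e1 (u : Sph d) : ∫ y, K (sdot u (ψ y)) ∂μ = ∑ z, c z * K (sdot u z) :=
    integral_comp_simpleFunc μ ψ fun z => K (sdot u z)
  have e2 : ∫ y, ∫ z, K (sdot (ψ y) (ψ z)) ∂μ ∂μ =
      ∑ y, c y * ∑ z, c z * K (sdot (y : Sph d) z) := by
    simp only [e1]
    exact integral_comp_simpleFunc μ ψ fun u => ∑ z, c z * K (sdot u z)
  have e3 : ∑ i, ∑ z, θ i * (-s * c z) * K (sdot (x i) z) =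
      -s * ∑ i, θ i * ∑ z, c z * K (sdot (x i) z) := by
    simp only [Finset.mul_sum]
    exact Finset.sum_congr rfl fun i _ => Finset.sum_congr rfl fun z _ => by ring
  have e4 : ∑ z, ∑ i, -s * c z * θ i * K (sdot (z : Sph d) (x i)) =
      -s * ∑ i, θ i * ∑ z, c z * K (sdot (x i) z) := by
    rw [Finset.sum_comm, ← e3]
    exact Finset.sum_congr rfl fun i _ => Finset.sum_congr rfl fun z _ => by
      rw [sdot_comm]; ring
  have e5 : ∑ y, ∑ z, -s * c y * (-s * c z) * K (sdot (y : Sph d) z) =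
      s ^ 2 * ∑ y, c y * ∑ z, c z * K (sdot (y : Sph d) z) := by
    simp only [Finset.mul_sum]
    exact Finset.sum_congr rfl fun i _ => Finset.sum_congr rfl fun z _ => by ring
  convert hT.isCentredGaussian_sum (Sum.elim x fun z : ψ.range => (z : Sph d))
    (Sum.elim θ fun z => -s * c z) using 2 with ω
  · rw [Fintype.sum_sum_type]
    simp only [Sum.elim_inl, Sum.elim_inr, mul_sub, Finset.sum_sub_distrib, mul_assoc, neg_mul,
      Finset.sum_neg_distrib, ← Finset.mul_sum, ← Finset.sum_mul]
    rw [integral_comp_simpleFunc μ ψ fun y => T ω y, sub_eq_add_neg]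
  · simp only [Fintype.sum_sum_type, Sum.elim_inl, Sum.elim_inr, Finset.sum_add_distrib]
    rw [e2, e3, e4, e5]
    simp only [e1]
    ring

theorem tendsto_integral_of_bounded {μ : Measure (Sph d)} [IsFiniteMeasure μ]
    {g : ℕ → Sph d → ℝ} {g₀ : Sph d → ℝ} {C : ℝ} (hg : ∀ n, Measurable (g n))
    (hC : ∀ᶠ n in atTop, ∀ y, |g n y| ≤ C)
    (hlim : ∀ y, Tendsto (fun n => g n y) atTop (𝓝 (g₀ y))) :
    Tendsto (fun n => ∫ y, g n y ∂μ) atTop (𝓝 (∫ y, g₀ y ∂μ)) :=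
  tendsto_integral_filter_of_dominated_convergence (fun _ => C)
    (Eventually.of_forall fun n => (hg n).aestronglyMeasurable)
    (hC.mono fun _ hn => Eventually.of_forall hn) (integrable_const C)
    (Eventually.of_forall hlim)

theorem tendsto_integral_integral_of_bounded {μ : Measure (Sph d)} [IsProbabilityMeasure μ]
    {k : ℕ → Sph d → Sph d → ℝ} {k₀ : Sph d → Sph d → ℝ} {C : ℝ}
    (hk : ∀ n, Measurable (Function.uncurry (k n)))
    (hC : ∀ᶠ n in atTop, ∀ y z, |k n y z| ≤ C)
    (hlim : ∀ y z, Tendsto (fun n => k n y z) atTop (𝓝 (k₀ y z))) :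
    Tendsto (fun n => ∫ y, ∫ z, k n y z ∂μ ∂μ) atTop (𝓝 (∫ y, ∫ z, k₀ y z ∂μ ∂μ)) := by
  refine tendsto_integral_of_bounded (C := C)
    (fun n => (hk n).stronglyMeasurable.integral_prod_right.measurable) (hC.mono fun n hn y => ?_)
    fun y => tendsto_integral_of_bounded (fun n => (hk n).of_uncurry_left)
      (hC.mono fun n hn z => hn y z) (hlim y)
  have := norm_integral_le_of_norm_le_const (μ := μ) (f := k n y)
    (Eventually.of_forall fun z => hn y z)
  simpa using this

/-- Linear functionals of the centred field are Gaussian: the mean over `μ` is a limit of Riemann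
sums. -/
theorem IsIsotropicField.isCentredGaussian_centred {T : Ω → C(Sph d, ℝ)} {K : ℝ → ℝ}
    (hT : IsIsotropicField P T K) (hK : ContinuousOn K (Icc (-1) 1))
    (μ : Measure (Sph d)) [IsProbabilityMeasure μ] {m : ℕ} (x : Fin m → Sph d) (θ : Fin m → ℝ) :
    IsCentredGaussian (fun ω => ∑ i, θ i * (T ω (x i) - ∫ y, T ω y ∂μ))
      (centredVar μ (fun y z => K (sdot y z)) x θ) P := by
  have hk : Continuous fun q : Sph d × Sph d => K (sdot q.1 q.2) :=
    hK.comp_continuous continuous_sdot fun q => sdot_mem_Icc _ _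
  obtain ⟨C, hC⟩ := isCompact_univ.exists_bound_of_continuousOn hk.continuousOn
  replace hC (y z : Sph d) : |K (sdot y z)| ≤ C := hC (y, z) (mem_univ _)
  let ψ : ℕ → SimpleFunc (Sph d) (Sph d) :=
    SimpleFunc.approxOn id measurable_id univ (northPole d) (mem_univ _)
  have hψ (y : Sph d) : Tendsto (fun n => ψ n y) atTop (𝓝 y) :=
    SimpleFunc.tendsto_approxOn measurable_id (mem_univ _) (by simp)
  clear_value ψ
  refine IsCentredGaussian.of_tendsto
    (fun n => hT.isCentredGaussian_centred_simpleFunc μ (ψ n) x θ) (fun ω => ?_) ?_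
  · have := tendsto_integral_of_bounded (μ := μ) (g := fun n y => T ω (ψ n y)) (g₀ := T ω)
      (C := ‖T ω‖) (fun n => (T ω).continuous.measurable.comp (ψ n).measurable)
      (Eventually.of_forall fun n y => (T ω).norm_coe_le_norm _)
      fun y => ((T ω).continuous.tendsto y).comp (hψ y)
    exact tendsto_finsetSum _ fun i _ => (this.const_sub (T ω (x i))).const_mul (θ i)
  · have h1 (u : Sph d) : Tendsto (fun n => ∫ y, K (sdot u (ψ n y)) ∂μ) atTop
        (𝓝 (∫ y, K (sdot u y) ∂μ)) :=
      tendsto_integral_of_bounded (C := C) (g := fun n y => K (sdot u (ψ n y)))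
        (fun n => hk.measurable.comp (measurable_const.prodMk (ψ n).measurable))
        (Eventually.of_forall fun n y => hC _ _)
        fun y => tendsto_comp_sdot hk tendsto_const_nhds (hψ y)
    have h2 : Tendsto (fun n => ∫ y, ∫ z, K (sdot (ψ n y) (ψ n z)) ∂μ ∂μ) atTop
        (𝓝 (∫ y, ∫ z, K (sdot y z) ∂μ ∂μ)) := by
      refine tendsto_integral_integral_of_bounded (C := C)
        (k := fun n y z => K (sdot (ψ n y) (ψ n z))) (fun n => ?_)
        (Eventually.of_forall fun n y z => hC _ _)
        fun y z => tendsto_comp_sdot hk (hψ y) (hψ z)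
      exact hk.measurable.comp (((ψ n).measurable.comp measurable_fst).prodMk
        ((ψ n).measurable.comp measurable_snd))
    have h3 : Tendsto (fun n => ∑ i, θ i * ∫ y, K (sdot (x i) (ψ n y)) ∂μ) atTop
        (𝓝 (∑ i, θ i * ∫ y, K (sdot (x i) y) ∂μ)) :=
      tendsto_finsetSum _ fun i _ => (h1 (x i)).const_mul (θ i)
    exact ((h3.const_mul (2 * ∑ i, θ i)).const_sub _).add (h2.const_mul ((∑ i, θ i) ^ 2))

theorem tendsto_centredVar {μ : Measure (Sph d)} [IsProbabilityMeasure μ]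
    {k : ℕ → Sph d → Sph d → ℝ} {k₀ : Sph d → Sph d → ℝ} {C : ℝ}
    (hk : ∀ n, Measurable (Function.uncurry (k n)))
    (hC : ∀ᶠ n in atTop, ∀ y z, |k n y z| ≤ C)
    (hlim : ∀ y z, Tendsto (fun n => k n y z) atTop (𝓝 (k₀ y z))) {m : ℕ} (x : Fin m → Sph d)
    (θ : Fin m → ℝ) :
    Tendsto (fun n => centredVar μ (k n) x θ) atTop (𝓝 (centredVar μ k₀ x θ)) := by
  refine Tendsto.add (Tendsto.sub ?_ (Tendsto.const_mul _ ?_)) (Tendsto.const_mul _ ?_)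
  · exact tendsto_finsetSum _ fun i _ => tendsto_finsetSum _ fun j _ =>
      (hlim _ _).const_mul _
  · exact tendsto_finsetSum _ fun i _ => Tendsto.const_mul _ <|
      tendsto_integral_of_bounded (fun n => (hk n).of_uncurry_left)
        (hC.mono fun n hn z => hn _ z) (hlim _)
  · exact tendsto_integral_integral_of_bounded hk hC hlim

/-- Centring kills the constant part of the covariance function. -/
theorem mul_centredVar {μ : Measure (Sph d)} [IsProbabilityMeasure μ] {k : Sph d → Sph d → ℝ}
    (hk : Continuous (Function.uncurry k)) (v : ℝ) {m : ℕ} (x : Fin m → Sph d) (θ : Fin m → ℝ) :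
    v * centredVar μ k x θ = -centredVar μ (fun y z => v * (1 - k y z)) x θ := by
  have hi (y : Sph d) : Integrable (k y) μ :=
    (hk.comp (Continuous.prodMk_right y)).integrable_of_hasCompactSupport
      (HasCompactSupport.of_compactSpace _)
  have hki : Continuous fun y => ∫ z, k y z ∂μ := by
    simpa using continuous_parametric_integral_of_continuous (μ := μ) hk isCompact_univ
  have hi2 : Integrable (fun y => ∫ z, k y z ∂μ) μ :=
    hki.integrable_of_hasCompactSupport (HasCompactSupport.of_compactSpace _)
  have e1 (y : Sph d) : ∫ z, v * (1 - k y z) ∂μ = v * (1 - ∫ z, k y z ∂μ) := by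
    rw [integral_const_mul, integral_sub (integrable_const _) (hi y)]
    simp
  have e2 : ∫ y, ∫ z, v * (1 - k y z) ∂μ ∂μ = v * (1 - ∫ y, ∫ z, k y z ∂μ ∂μ) := by
    simp only [e1]
    rw [integral_const_mul, integral_sub (integrable_const _) hi2]
    simp
  have e3 : ∑ i, ∑ j, θ i * θ j * (v * (1 - k (x i) (x j))) =
      v * ((∑ i, θ i) ^ 2 - ∑ i, ∑ j, θ i * θ j * k (x i) (x j)) := by
    rw [sq, Finset.sum_mul_sum, ← Finset.sum_sub_distrib, Finset.mul_sum]
    simp only [← Finset.sum_sub_distrib, Finset.mul_sum]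
    exact Finset.sum_congr rfl fun i _ => Finset.sum_congr rfl fun j _ => by ring
  have e4 : ∑ i, θ i * (v * (1 - ∫ z, k (x i) z ∂μ)) =
      v * (∑ i, θ i - ∑ i, θ i * ∫ z, k (x i) z ∂μ) := by
    rw [← Finset.sum_sub_distrib, Finset.mul_sum]
    exact Finset.sum_congr rfl fun i _ => by ring
  simp only [centredVar]
  rw [e2, e3]
  simp only [e1]
  rw [e4]
  ring

/-- The rescaled variances of the centred iterated fields converge. -/
theorem tendsto_speed_mul_centredVar {κ : ℝ → ℝ} {c ρ : ℝ} (hκ : IsKernel κ)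
    (hd : derivOne κ = 1) (hA : CovRegular κ c ρ) (μ : Measure (Sph d)) [IsProbabilityMeasure μ]
    {m : ℕ} (x : Fin m → Sph d) (θ : Fin m → ℝ) :
    Tendsto (fun L => speed ρ L * centredVar μ (fun y z => κ^[L] (sdot y z)) x θ) atTop
      (𝓝 (-centredVar μ (fun y z => profile κ c ρ (sdot y z)) x θ)) := by
  have hk (L : ℕ) : Continuous fun q : Sph d × Sph d => κ^[L] (sdot q.1 q.2) :=
    (hκ.continuousOn_iterate L).comp_continuous continuous_sdot fun q => sdot_mem_Icc _ _
  obtain ⟨C, hC⟩ := exists_profile_bound hκ hd hA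
  have := tendsto_centredVar (μ := μ)
    (k := fun L y z => speed ρ L * (1 - κ^[L] (sdot y z)))
    (fun L => ((continuous_const.sub (hk L)).const_mul _).measurable)
    (hC.mono fun L hL y z => hL _ (sdot_mem_Icc y z))
    (fun y z => tendsto_profile hκ hd hA (sdot_mem_Icc y z)) x θ
  refine this.neg.congr fun L => ?_
  exact (mul_centredVar (k := fun y z => κ^[L] (sdot y z)) (hk L) (speed ρ L) x θ).symm

end Gaussian


/-! ### Gaussian estimates on the logarithmic scale -/

section LDP

variable {Ω : Type*} [MeasurableSpace Ω] {P : Measure Ω}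

/-- Chernoff's bound. -/
theorem IsCentredGaussian.measure_ge_le [IsProbabilityMeasure P] {Y : Ω → ℝ} {V : ℝ}
    (hY : IsCentredGaussian Y V P) (a : ℝ) {v : ℝ} (hv : 0 ≤ v) :
    P {ω | a ≤ Y ω} ≤ ENNReal.ofReal (Real.exp (v * (-a + v * V / 2))) := by
  have hint : Integrable (fun ω => Real.exp (v * Y ω)) P := by
    have h := integrable_exp_mul_gaussianReal (μ := 0) (v := V.toNNReal) v
    rw [← hY.2.map_eq] at h
    exact h.comp_aemeasurable hY.2.aemeasurable
  have h := measure_ge_le_exp_mul_mgf a hv hint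
  rw [mgf_gaussianReal hY.2.map_eq, ← Real.exp_add, Real.coe_toNNReal _ hY.1] at h
  rw [← ofReal_measureReal]
  refine ENNReal.ofReal_le_ofReal (h.trans (le_of_eq ?_))
  congr 1
  ring

theorem IsCentredGaussian.le_measure_ge {Y : Ω → ℝ} {V : ℝ} (hY : IsCentredGaussian Y V P)
    (hV : 0 < V) (hV' : 2 * Real.pi * V ≤ 1) :
    ENNReal.ofReal (Real.exp (-2 / V)) ≤ P {ω | 1 ≤ Y ω} := by
  have h1 : P {ω | 1 ≤ Y ω} = gaussianReal 0 V.toNNReal (Ici 1) := by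
    rw [← hY.2.map_eq, Measure.map_apply_of_aemeasurable hY.2.aemeasurable measurableSet_Ici]
    rfl
  rw [h1, gaussianReal_apply _ (by simpa using hV)]
  calc ENNReal.ofReal (Real.exp (-2 / V))
      = ∫⁻ _ in Icc (1 : ℝ) 2, ENNReal.ofReal (Real.exp (-2 / V)) := by
        rw [setLIntegral_const, Real.volume_Icc]
        norm_num
    _ ≤ ∫⁻ x in Icc (1 : ℝ) 2, gaussianPDF 0 V.toNNReal x := by
        refine setLIntegral_mono' measurableSet_Icc fun x hx => ENNReal.ofReal_le_ofReal ?_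
        rw [gaussianPDFReal, Real.coe_toNNReal _ hV.le]
        have h2 : 1 ≤ (√(2 * Real.pi * V))⁻¹ :=
          (one_le_inv₀ (by positivity)).2 (Real.sqrt_le_one.2 hV')
        have h3 : -2 / V ≤ -(x - 0) ^ 2 / (2 * V) := by
          rw [div_le_div_iff₀ hV (by positivity)]
          have : x ^ 2 ≤ 4 := by nlinarith [hx.1, hx.2]
          nlinarith
        calc Real.exp (-2 / V) ≤ Real.exp (-(x - 0) ^ 2 / (2 * V)) := Real.exp_le_exp.2 h3
          _ ≤ _ := le_mul_of_one_le_left (Real.exp_pos _).le h2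
    _ ≤ ∫⁻ x in Ici (1 : ℝ), gaussianPDF 0 V.toNNReal x :=
        lintegral_mono_set Icc_subset_Ici_self

theorem log_ofReal_exp (r : ℝ) : ENNReal.log (ENNReal.ofReal (Real.exp r)) = r := by
  rw [ENNReal.log_ofReal_of_pos (Real.exp_pos r), Real.log_exp]

theorem one_div_mul_coe {v : ℝ} (hv : 0 < v) (r : ℝ) :
    ((1 / v : ℝ) : EReal) * ((v * r : ℝ) : EReal) = r := by
  rw [← EReal.coe_mul]
  congr 1
  field_simp

theorem logProb_le {𝒳 : Type*} {X : ℕ → Ω → 𝒳} {v : ℕ → ℝ} {A : Set 𝒳} {L : ℕ} {r : ℝ}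
    (hv : 0 < v L) (h : P {ω | X L ω ∈ A} ≤ ENNReal.ofReal (Real.exp (v L * r))) :
    logProb P X v A L ≤ r := by
  have h1 : (0 : EReal) ≤ ((1 / v L : ℝ) : EReal) := EReal.coe_nonneg.2 (by positivity)
  refine (mul_le_mul_of_nonneg_left (ENNReal.log_monotone h) h1).trans (le_of_eq ?_)
  rw [log_ofReal_exp, one_div_mul_coe hv]

theorem le_logProb {𝒳 : Type*} {X : ℕ → Ω → 𝒳} {v : ℕ → ℝ} {A : Set 𝒳} {L : ℕ} {r : ℝ}
    (hv : 0 < v L) (h : ENNReal.ofReal (Real.exp (v L * r)) ≤ P {ω | X L ω ∈ A}) :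
    r ≤ logProb P X v A L := by
  have h1 : (0 : EReal) ≤ ((1 / v L : ℝ) : EReal) := EReal.coe_nonneg.2 (by positivity)
  refine le_trans (le_of_eq ?_) (mul_le_mul_of_nonneg_left (ENNReal.log_monotone h) h1)
  rw [log_ofReal_exp, one_div_mul_coe hv]

/-! ### Why no large deviation principle can hold -/

section General

variable {𝒳 : Type*} [TopologicalSpace 𝒳] {X : ℕ → Ω → 𝒳} {v : ℕ → ℝ} {I : 𝒳 → ℝ≥0∞}
  {ℓ : 𝒳 → ℝ} {V : ℕ → ℝ} {σ : ℝ}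

/-- The lower bound of the principle on the half-spaces `{ℓ > a}` together with Chernoff's bound
forces every rate function to dominate the Legendre transform of the limiting variance. -/
theorem SatisfiesLDP.sub_le_rate [IsProbabilityMeasure P] (hI : SatisfiesLDP P X v I)
    (hv : Tendsto v atTop atTop) (hℓ : Continuous ℓ)
    (hV : ∀ L, 1 ≤ L → IsCentredGaussian (fun ω => ℓ (X L ω)) (V L) P)
    (hlim : Tendsto (fun L => v L * V L) atTop (𝓝 σ)) (f : 𝒳) :
    ((ℓ f - 1 / 2 * σ : ℝ) : EReal) ≤ I f := by
  by_contra! hlt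
  obtain ⟨r, hr1, hr2⟩ := EReal.lt_iff_exists_real_btwn.1 hlt
  have ha : r + 1 / 2 * σ < ℓ f := by linarith [EReal.coe_lt_coe_iff.1 hr2]
  set a := r + 1 / 2 * σ with hadef
  have hup : liminf (logProb P X v {g | a < ℓ g}) atTop ≤ ((-r : ℝ) : EReal) := by
    have hto : Tendsto (fun L => ((-a + v L * V L / 2 : ℝ) : EReal)) atTop
        (𝓝 ((-r : ℝ) : EReal)) := by
      refine (continuous_coe_real_ereal.tendsto _).comp ?_
      have := (hlim.div_const 2).const_add (-a)
      rwa [show -a + σ / 2 = -r by rw [hadef]; ring] at this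
    rw [← hto.liminf_eq]
    refine liminf_le_liminf ?_
    filter_upwards [hv.eventually_gt_atTop 0, eventually_ge_atTop 1] with L hL hL1
    refine logProb_le hL (le_trans (measure_mono fun ω hω => ?_)
      ((hV L hL1).measure_ge_le a hL.le))
    exact (show a < ℓ (X L ω) from hω).le
  have hlow := (hI.lower {g | a < ℓ g} (isOpen_lt continuous_const hℓ)).trans hup
  rw [EReal.coe_neg, EReal.neg_le_neg_iff] at hlow
  exact absurd (hlow.trans (iInf₂_le f ha)) hr1.not_ge

/-- The upper bound on the closed set `{ℓ ≥ 1}` forces the rate function to be finite somewhere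
on it. -/
theorem SatisfiesLDP.exists_rate_lt_top (hI : SatisfiesLDP P X v I) (hv : Tendsto v atTop atTop)
    (hℓ : Continuous ℓ) (hV : ∀ L, 1 ≤ L → IsCentredGaussian (fun ω => ℓ (X L ω)) (V L) P)
    (hlim : Tendsto (fun L => v L * V L) atTop (𝓝 σ)) (hσ : 0 < σ) :
    ∃ f, 1 ≤ ℓ f ∧ I f < ⊤ := by
  by_contra! hall
  have hinf : ⨅ x ∈ {g | 1 ≤ ℓ g}, (I x : EReal) = ⊤ :=
    iInf₂_eq_top.2 fun f hf => by rw [top_le_iff.1 (hall f hf)]; rfl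
  have hup := hI.upper {g | 1 ≤ ℓ g} (isClosed_le continuous_const hℓ)
  rw [hinf, EReal.neg_top] at hup
  have hto : Tendsto (fun L => ((-2 / (v L * V L) : ℝ) : EReal)) atTop
      (𝓝 ((-2 / σ : ℝ) : EReal)) :=
    (continuous_coe_real_ereal.tendsto _).comp (tendsto_const_nhds.div hlim hσ.ne')
  have hV0 : Tendsto (fun L => 2 * Real.pi * V L) atTop (𝓝 0) := by
    have h := ((hlim.mul (tendsto_inv_atTop_zero.comp hv)).const_mul (2 * Real.pi))
    rw [mul_zero, mul_zero] at h
    refine h.congr' ?_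
    filter_upwards [hv.eventually_gt_atTop 0] with L hL
    simp only [Function.comp_apply]
    field_simp
  have hle : ((-2 / σ : ℝ) : EReal) ≤ limsup (logProb P X v {g | 1 ≤ ℓ g}) atTop := by
    rw [← hto.limsup_eq]
    refine limsup_le_limsup ?_
    filter_upwards [hv.eventually_gt_atTop 0, eventually_ge_atTop 1,
      hlim.eventually_const_lt hσ, hV0.eventually_le_const one_pos] with L hL hL1 hpos hsmall
    have hVL : 0 < V L := pos_of_mul_pos_right hpos hL.le
    refine le_logProb hL (le_trans (le_of_eq ?_) ((hV L hL1).le_measure_ge hVL hsmall))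
    congr 2
    field_simp
  exact absurd (hle.trans hup) (by simp)

end General

variable {d : ℕ}

/-- A rate function would have to be infinite off the zero function, because it dominates `supRate`,
and finite at some function that does not vanish at `p`. -/
theorem not_satisfiesLDP [IsProbabilityMeasure P] {X : ℕ → Ω → C(Sph d, ℝ)} {v : ℕ → ℝ}
    (hv : Tendsto v atTop atTop)
    {B : ∀ {m : ℕ}, (Fin m → Sph d) → Matrix (Fin m) (Fin m) ℝ}
    {V : ∀ {m : ℕ}, (Fin m → Sph d) → (Fin m → ℝ) → ℕ → ℝ}
    (hV : ∀ {m : ℕ} (x : Fin m → Sph d) (θ : Fin m → ℝ) (L : ℕ), 1 ≤ L →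
      IsCentredGaussian (fun ω => ∑ i, θ i * X L ω (x i)) (V x θ L) P)
    (hlim : ∀ {m : ℕ} (x : Fin m → Sph d) (θ : Fin m → ℝ),
      Tendsto (fun L => v L * V x θ L) atTop (𝓝 (θ ⬝ᵥ (B x *ᵥ θ))))
    {p : Sph d} (hp : 0 < B (fun _ : Fin 1 => p) 0 0)
    (htop : ∀ f : C(Sph d, ℝ), f ≠ 0 → supRate B f = ⊤) :
    ¬ ∃ I : C(Sph d, ℝ) → ℝ≥0∞, SatisfiesLDP P X v I := by
  rintro ⟨I, hI⟩
  have hcont {m : ℕ} (x : Fin m → Sph d) (θ : Fin m → ℝ) :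
      Continuous fun g : C(Sph d, ℝ) => ∑ i, θ i * g (x i) := by fun_prop
  have hle (f : C(Sph d, ℝ)) : supRate B f ≤ I f :=
    iSup_le fun m => iSup_le fun _ => iSup_le fun x => iSup_le fun _ => iSup_le fun θ =>
      hI.sub_le_rate hv (hcont x θ) (hV x θ) (hlim x θ) f
  obtain ⟨f, hf1, hf2⟩ := hI.exists_rate_lt_top hv (hcont (fun _ : Fin 1 => p) fun _ => 1)
    (hV _ _) (hlim _ _) (by simpa [dotProduct, Matrix.mulVec] using hp)
  have hf0 : f ≠ 0 := by
    rintro rfl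
    simp at hf1
    linarith
  have h := hle f
  rw [htop f hf0, top_le_iff, EReal.coe_ennreal_eq_top_iff] at h
  exact hf2.ne h

end LDP

/-! ### The two centrings -/

section Centrings

variable {d : ℕ}

/-- The normalised surface measure. -/
def unifSph (d : ℕ) : Measure (Sph d) := (surf d univ)⁻¹ • surf d

instance : IsFiniteMeasure (surf d) := by
  unfold surf
  infer_instance

theorem surf_univ_ne_zero : surf d univ ≠ 0 := by
  rw [Measure.measure_univ_ne_zero, surf]
  exact Measure.toSphere_ne_zero _

instance : IsProbabilityMeasure (unifSph d) :=
  ⟨by rw [unifSph, Measure.smul_apply, smul_eq_mul,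
    ENNReal.inv_mul_cancel surf_univ_ne_zero (measure_ne_top _ _)]⟩

theorem surf_singleton (hd : 1 ≤ d) (u : Sph d) : surf d {u} = 0 := by
  rw [surf, Measure.toSphere_apply' _ (measurableSet_singleton u)]
  refine mul_eq_zero_of_right _ (measure_mono_null
    (t := Submodule.span ℝ {(u : EuclideanSpace ℝ (Fin (d + 1)))}) ?_
    (Measure.addHaar_submodule _ (Submodule.span ℝ {(u : EuclideanSpace ℝ (Fin (d + 1)))})
      fun htop => ?_))
  · rw [image_singleton]
    rintro _ ⟨r, -, _, rfl, rfl⟩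
    exact Submodule.smul_mem _ _ (Submodule.mem_span_singleton_self _)
  · have hu : (u : EuclideanSpace ℝ (Fin (d + 1))) ≠ 0 := ne_zero_of_mem_unit_sphere u
    have h := finrank_span_singleton (K := ℝ) hu
    rw [htop, finrank_top, finrank_euclideanSpace_fin] at h
    omega

theorem integral_unifSph (f : Sph d → ℝ) :
    ∫ y, f y ∂(unifSph d) = (totalArea d)⁻¹ * ∫ y, f y ∂(surf d) := by
  rw [unifSph, integral_smul_measure, ENNReal.toReal_inv, totalArea, smul_eq_mul, measureReal_def]

theorem centreMean_apply (f : C(Sph d, ℝ)) (x : Sph d) :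
    centreMean f x = f x - ∫ y, f y ∂(unifSph d) := by
  have h0 : 0 ≤ totalArea d := measureReal_nonneg
  simp only [centreMean, a00, ContinuousMap.sub_apply, ContinuousMap.const_apply]
  rw [integral_unifSph, integral_mul_const, mul_one_div, div_div, Real.mul_self_sqrt h0,
    div_eq_inv_mul]

theorem centreNorth_apply (f : C(Sph d, ℝ)) (x : Sph d) :
    centreNorth f x = f x - ∫ y, f y ∂(Measure.dirac (northPole d)) := by
  rw [integral_dirac]
  rfl

variable {S : ℝ → ℝ} {s : ℝ}

theorem integral_unifSph_profile (hd : 1 ≤ d) (hS : ∀ t ∈ Ioo (-1 : ℝ) 1, S t = s) (u : Sph d) :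
    ∫ y, S (sdot u y) ∂(unifSph d) = s := by
  have hnull (z : Sph d) : ∀ᵐ y ∂(unifSph d), z ≠ y := by
    have : unifSph d {z} = 0 := by
      rw [unifSph, Measure.smul_apply, surf_singleton hd, smul_zero]
    filter_upwards [measure_eq_zero_iff_ae_notMem.1 this] with y hy h
    exact hy h.symm
  have hae : (fun y => S (sdot u y)) =ᵐ[unifSph d] fun _ => s := by
    filter_upwards [hnull u, hnull (-u)] with y h1 h2
    exact hS _ (sdot_mem_Ioo h1 fun h => h2 (by rw [h, neg_neg]))
  rw [integral_congr_ae hae]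
  simp

theorem dotProduct_B₁ (h1 : S 1 = 0) {m : ℕ} (x : Fin m → Sph d) (θ : Fin m → ℝ) :
    θ ⬝ᵥ (B₁ S x *ᵥ θ) =
      -centredVar (Measure.dirac (northPole d)) (fun y z => S (sdot y z)) x θ := by
  simp only [centredVar, integral_dirac, sdot_self, h1, dotProduct, Matrix.mulVec, B₁,
    Matrix.of_apply]
  have hsplit (i : Fin m) : θ i * ∑ j, (S (sdot (x i) (northPole d)) +
      S (sdot (x j) (northPole d)) - S (sdot (x i) (x j))) * θ j =
      θ i * S (sdot (x i) (northPole d)) * ∑ j, θ j +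
        θ i * ∑ j, θ j * S (sdot (x j) (northPole d)) -
          ∑ j, θ i * θ j * S (sdot (x i) (x j)) := by
    simp only [Finset.mul_sum, ← Finset.sum_add_distrib, ← Finset.sum_sub_distrib]
    exact Finset.sum_congr rfl fun j _ => by ring
  rw [Finset.sum_congr rfl fun i _ => hsplit i, Finset.sum_sub_distrib, Finset.sum_add_distrib,
    ← Finset.sum_mul, ← Finset.sum_mul]
  ring

theorem dotProduct_B₂ (hd : 1 ≤ d) (hS : ∀ t ∈ Ioo (-1 : ℝ) 1, S t = s) {m : ℕ}
    (x : Fin m → Sph d) (θ : Fin m → ℝ) :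
    θ ⬝ᵥ (B₂ S x *ᵥ θ) = -centredVar (unifSph d) (fun y z => S (sdot y z)) x θ := by
  rw [B₂_eq hd hS]
  simp only [centredVar, integral_unifSph_profile hd hS, dotProduct, Matrix.mulVec,
    Matrix.of_apply]
  have hsplit (i : Fin m) : θ i * ∑ j, (s - S (sdot (x i) (x j))) * θ j =
      θ i * (s * ∑ j, θ j) - ∑ j, θ i * θ j * S (sdot (x i) (x j)) := by
    simp only [Finset.mul_sum, ← Finset.sum_sub_distrib]
    exact Finset.sum_congr rfl fun j _ => by ring
  rw [Finset.sum_congr rfl fun i _ => hsplit i, Finset.sum_sub_distrib, ← Finset.sum_mul,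
    ← Finset.sum_mul]
  simp
  ring

theorem tendsto_speed {ρ : ℝ} (hρ : 1 < ρ) : Tendsto (speed ρ) atTop atTop :=
  (tendsto_rpow_atTop (one_div_pos.2 (sub_pos.2 hρ))).comp tendsto_natCast_atTop_atTop

end Centrings

end SparseField

end

theorem theorem4p2 {Ω : Type*} [MeasurableSpace Ω] (P : Measure Ω) [IsProbabilityMeasure P]
    (d : ℕ) (hd : 1 ≤ d) (κ : ℝ → ℝ) (hκ : SparseField.IsKernel κ)
    (hsparse : SparseField.derivOne κ = 1)
    (c ρ : ℝ) (hA : SparseField.CovRegular κ c ρ)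
    (T : ℕ → Ω → C(SparseField.Sph d, ℝ))
    (hT : ∀ L : ℕ, 1 ≤ L → SparseField.IsIsotropicField P (T L) (κ^[L])) :
    (¬ ∃ I : C(SparseField.Sph d, ℝ) → ℝ≥0∞,
      SparseField.SatisfiesLDP P (fun L ω => SparseField.centreNorth (T L ω))
        (SparseField.speed ρ) I) ∧
    (¬ ∃ I : C(SparseField.Sph d, ℝ) → ℝ≥0∞,
      SparseField.SatisfiesLDP P (fun L ω => SparseField.centreMean (T L ω))
        (SparseField.speed ρ) I) ∧
    ∃ S : ℝ → ℝ,
      (∀ t ∈ Icc (-1 : ℝ) 1,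
        Tendsto (fun L : ℕ => SparseField.speed ρ L * (1 - κ^[L] t)) atTop (𝓝 (S t))) ∧
      (∀ f : C(SparseField.Sph d, ℝ), (¬ ∃ a : ℝ, ∀ x, f x = a) →
        SparseField.supRate (SparseField.B₁ S) f = ⊤) ∧
      (∀ f : C(SparseField.Sph d, ℝ), f ≠ 0 → SparseField.supRate (SparseField.B₂ S) f = ⊤) ∧
      SparseField.MarginalsFail (d := d) (SparseField.B₁ S) ∧
      SparseField.MarginalsFail (d := d) (SparseField.B₂ S) := by
  have hs := SparseField.profileConst_pos hκ hsparse hA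
  have h1 : SparseField.profile κ c ρ 1 = 0 := SparseField.profile_one hκ
  have hS : ∀ t ∈ Ioo (-1 : ℝ) 1, SparseField.profile κ c ρ t = SparseField.profileConst c ρ :=
    fun t ht => SparseField.profile_of_mem_Ioo hκ ht
  have hv := SparseField.tendsto_speed hA.2.1
  refine ⟨?_, ?_, SparseField.profile κ c ρ,
    fun t ht => SparseField.tendsto_profile hκ hsparse hA ht,
    fun f hf => SparseField.supRate_B₁_of_not_const hd hs h1 hS hf,
    fun f hf => SparseField.supRate_B₂_of_ne_zero hd hs h1 hS hf,
    SparseField.marginalsFail_B₁ hd hs h1 hS, SparseField.marginalsFail_B₂ hd hs h1 hS⟩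
  · obtain ⟨p, hp⟩ := SparseField.exists_B₁_pos hd hs h1 hS
    refine SparseField.not_satisfiesLDP hv (B := SparseField.B₁ (SparseField.profile κ c ρ))
      (V := fun x θ L => SparseField.centredVar (Measure.dirac (SparseField.northPole d))
        (fun y z => κ^[L] (SparseField.sdot y z)) x θ)
      (fun x θ L hL => ?_) (fun x θ => ?_) (p := p) hp
      fun f hf => SparseField.supRate_B₁_of_ne_zero hd hs h1 hS hf
    · simp only [SparseField.centreNorth_apply]
      exact (hT L hL).isCentredGaussian_centred (hκ.continuousOn_iterate L) _ x θ
    · rw [SparseField.dotProduct_B₁ h1]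
      exact SparseField.tendsto_speed_mul_centredVar hκ hsparse hA _ x θ
  · refine SparseField.not_satisfiesLDP hv (B := SparseField.B₂ (SparseField.profile κ c ρ))
      (V := fun x θ L => SparseField.centredVar (SparseField.unifSph d)
        (fun y z => κ^[L] (SparseField.sdot y z)) x θ)
      (fun x θ L hL => ?_) (fun x θ => ?_) (p := SparseField.northPole d) ?_
      fun f hf => SparseField.supRate_B₂_of_ne_zero hd hs h1 hS hf
    · simp only [SparseField.centreMean_apply]
      exact (hT L hL).isCentredGaussian_centred (hκ.continuousOn_iterate L) _ x θ
    · rw [SparseField.dotProduct_B₂ hd hS]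
      exact SparseField.tendsto_speed_mul_centredVar hκ hsparse hA _ x θ
    · rw [SparseField.B₂_eq hd hS]
      simpa [SparseField.sdot_self, h1] using hs
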